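/- Let $p_Z$ be a probability density function on $\mathbb{R}$ and let $\Delta>0$. Consider the memoryless additive-noise channel $Y_i=X_i+Z_i$, $i=1,\dots,n$, where $Z_1,\dots,Z_n$ are i.i.d. with density $p_Z$. A code of length $n$ with finite nonempty message set $\mathcal M$ and finite nonempty key set $\mathcal K$ is a pair consisting of an encoder $f\colon\mathcal M\times\mathcal K\to\mathbb R^n$ and a (measurable) decoder $g\colon\mathbb R^n\times\mathcal K\to\mathcal M$; message and key are uniform, independent of each other and of the noise $Z^n$, and $X^n$ is the encoder's output. Let $P_{Y^n}$ be the resulting law of $Y^n=X^n+Z^n$ (averaged over message and key) and $P_{Z^n}$ the law of $Z^n$. For $\epsilon>0$ let $A_n(\Delta,\epsilon)$ be the maximum of $\ln|\mathcal M|$ over all codes of length $n$ (with any finite key set) that satisfy $D(P_{Y^n}\|P_{Z^n})\le\Delta$ and whose probability of decoding error, averaged over message and key, is at most $\epsilon$. Define $$L=\lim_{\epsilon\downarrow0}\ \liminf_{n\to\infty}\frac{A_n(\Delta,\epsilon)}{\sqrt{n\Delta}}.$$ Assume that for some $\zeta\in(0,1)$ $$\int_{\mathbb R} p_Z(\ln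 p_Z)^4\,dz<\infty,\qquad \int_{\mathbb R} p_Z^{\zeta}\,dz<\infty,\qquad \int_{\mathbb R} p_Z^{\zeta}(\ln p_Z)^4\,dz<\infty,$$ and that 1. $p_Z$ is bounded; 2. $z\mapsto p_Z(z)\ln p_Z(z)$ is uniformly continuous on $\operatorname{supp}(p_Z)=\{z: p_Z(z)\neq 0\}$; 3. there is $\xi\in(0,1)$ such that for every $\gamma\in[0,\xi)$ there is a random variable $X$, independent of $Z\sim p_Z$, such that $X+Z$ has the density $\alpha\,p_Z^{1-\gamma}$, where $\alpha=\bigl(\int_{\mathbb R}p_Z(z)^{1-\gamma}\,dz\bigr)^{-1}$. Then the limit $L$ exists and $$L=\sqrt2\,\sqrt{\operatorname{Var}[\ln p_Z(Z)]},\qquad Z\sim p_Z.$$ -/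

import Mathlib

open MeasureTheory ProbabilityTheory Filter Topology

noncomputable section

namespace Covert

/-- `p` is a probability density function on `ℝ` with respect to Lebesgue measure. -/
structure IsPDF (p : ℝ → ℝ) : Prop where
  nonneg : ∀ z, 0 ≤ p z
  integrable : Integrable p volume
  integral_eq_one : ∫ z, p z = 1

/-- The measure on `ℝ` with Lebesgue density `p`. -/
def lawOf (p : ℝ → ℝ) : Measure ℝ :=
  volume.withDensity fun z => ENNReal.ofReal (p z)

/-- The law of the noise vector `Zⁿ` whose coordinates are i.i.d. with density `p`. -/
def noiseLaw (p : ℝ → ℝ) (n : ℕ) : Measure (Fin n → ℝ) :=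
  Measure.pi fun _ => lawOf p

/-- A code of length `n` for the message set `Fin M` and the key set `Fin K`: an encoder, and a
decoder with measurable decision regions. -/
structure Code (n M K : ℕ) where
  encode : Fin M → Fin K → (Fin n → ℝ)
  decode : (Fin n → ℝ) → Fin K → Fin M
  measurableSet_decode : ∀ k m, MeasurableSet {y | decode y k = m}

/-- The law of the channel output `Yⁿ = Xⁿ + Zⁿ` when the message and the key are uniform,
independent of each other and of the noise. -/
def Code.outputLaw {n M K : ℕ} (C : Code n M K) (p : ℝ → ℝ) : Measure (Fin n → ℝ) :=
  ((K : ENNReal) * (M : ENNReal))⁻¹ •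
    ∑ m : Fin M, ∑ k : Fin K, (noiseLaw p n).map fun z => C.encode m k + z

/-- The probability of decoding error, averaged over the message and the key. -/
def Code.errorProb {n M K : ℕ} (C : Code n M K) (p : ℝ → ℝ) : ℝ :=
  ((K : ℝ) * (M : ℝ))⁻¹ *
    ∑ m : Fin M, ∑ k : Fin K,
      (noiseLaw p n).real {z | C.decode (C.encode m k + z) k ≠ m}

/-- There is a code of length `n` with `M` messages (and some finite nonempty key set) that
satisfies `D(P_{Yⁿ} ‖ P_{Zⁿ}) ≤ Δ` and has average error probability at most `ε`. -/
def Achievable (p : ℝ → ℝ) (n : ℕ) (Δ ε : ℝ) (M : ℕ) : Prop :=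
  0 < M ∧ ∃ K : ℕ, 0 < K ∧ ∃ C : Code n M K,
    InformationTheory.klDiv (C.outputLaw p) (noiseLaw p n) ≤ ENNReal.ofReal Δ ∧
    C.errorProb p ≤ ε

/-- `A_n(Δ, ε)`: the largest `ln |M|` over all covert and reliable codes of length `n`, as a
supremum in the extended reals. -/
def maxLogSize (p : ℝ → ℝ) (n : ℕ) (Δ ε : ℝ) : EReal :=
  ⨆ (M : ℕ) (_ : Achievable p n Δ ε M), ((Real.log M : ℝ) : EReal)

/-- `L = lim_{ε ↓ 0} liminf_{n → ∞} A_n(Δ, ε) / √(n Δ)`, existence of the limit included. -/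
def IsScalingConstant (p : ℝ → ℝ) (Δ L : ℝ) : Prop :=
  Tendsto
    (fun ε : ℝ => liminf (fun n : ℕ => maxLogSize p n Δ ε / ((√(n * Δ) : ℝ) : EReal)) atTop)
    (𝓝[>] 0) (𝓝 (L : EReal))

/-- The integrability conditions on the noise density. -/
def IntegrabilityConditions (p : ℝ → ℝ) : Prop :=
  ∃ ζ ∈ Set.Ioo (0 : ℝ) 1,
    Integrable (fun z => p z * Real.log (p z) ^ 4) volume ∧
    Integrable (fun z => p z ^ ζ) volume ∧
    Integrable (fun z => p z ^ ζ * Real.log (p z) ^ 4) volume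

/-- The tilted density `α p^{1-γ}`, with `α` the inverse of `∫ p^{1-γ}`. -/
def tilted (p : ℝ → ℝ) (γ : ℝ) (z : ℝ) : ℝ :=
  (∫ t, p t ^ (1 - γ))⁻¹ * p z ^ (1 - γ)

/-- There is a random variable `X`, independent of some `Z` with density `p`, such that `X + Z`
has density `q`. -/
def IsAdditiveOutput (p q : ℝ → ℝ) : Prop :=
  ∃ (Ω : Type) (_ : MeasurableSpace Ω) (P : Measure Ω) (X Z : Ω → ℝ),
    IsProbabilityMeasure P ∧ Measurable X ∧ Measurable Z ∧ IndepFun X Z P ∧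
    P.map Z = lawOf p ∧ P.map (fun ω => X ω + Z ω) = lawOf q

/-- The additional assumptions on the noise density: it is bounded, `p ln p` is uniformly
continuous on the support of `p`, and for all small `γ` the tilted density is the density of
`X + Z` for some `X` independent of `Z`. -/
structure TightnessAssumption (p : ℝ → ℝ) : Prop where
  bounded : ∃ b > 0, ∀ z, p z ≤ b
  uniformContinuousOn :
    UniformContinuousOn (fun z => p z * Real.log (p z)) (Function.support p)
  decomposable : ∃ ξ ∈ Set.Ioo (0 : ℝ) 1, ∀ γ ∈ Set.Ico 0 ξ, IsAdditiveOutput p (tilted p γ)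

end Covert

end

namespace Covert

open scoped ENNReal

/-! ### Product densities and two entropy inequalities -/

section General

variable {X Y : Type*} [MeasurableSpace X] [MeasurableSpace Y]

/-! Write `S = -ln p` for the surprisal, `Λ` for its cumulant generating function under the noise
law, `H = Λ'(0)` and `V = Λ''(0) = Var[ln p(Z)]`. Since `exp Λ(γ) = ∫ p^(1-γ)`, the densities `α
p^(1-γ)` form the exponential family obtained by tilting the noise law by `S`. The integrability of
`p^ζ` and the boundedness of `p` make `Λ` analytic below `1 - ζ`. Both bounds use the tilt `γ = c /
√n`.

Converse (`RegularDensity.log_card_le`). Donsker–Varadhan applied to `γ S` turns the covertness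
constraint into a bound on the mean total surprisal of the output, at most `(Δ + n Λ(γ)) / γ`. A
change of measure from each codeword's output law to the tilted product law, summed over the
disjoint decision regions, bounds `(1-ε) ln M` by `n (Λ(γ) - γ H) / γ + Δ / γ + 1`. As `Λ(γ) - γ H ~
γ² V / 2`, this is about `√n (c V / 2 + Δ / c)`. For `V > 0` the minimum over `c` is `√n √(2 Δ V)`.

Achievability (`RegularDensity.achievable_of_le`). The decomposability assumption gives an input law
whose output is exactly the tilted law. Codewords are drawn i.i.d. from it. With many keys the
expected divergence of the output law from the noise law is asymptotically at most that of the
tilted law, `n (γ Λ'(γ) - Λ(γ)) ~ c² V / 2`, which is below `Δ` when `c < √(2 Δ / V)`. The mutual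
information is about `n γ V = c V √n`, and threshold decoding reaches any smaller rate on this scale
provided that the information density deviates from its mean by only `o(√n)`.

By Chebyshev this deviation bound needs the per-letter variance to tend to zero with `γ`
(`RegularDensity.eventually_variance_le`). The reason is that the input is weak: a Hellinger-type
distance between `p(X+Z)` and `p(Z)` is controlled by `Λ'(γ) - H`, which vanishes, and exponential
moments of `S` absorb the region where `p` is small and the logarithm is steep. -/

theorem lintegral_pi_prod_ofReal {ι : Type*} [Fintype ι] {E : ι → Type*}
    [∀ i, MeasurableSpace (E i)] (μ : ∀ i, Measure (E i)) [∀ i, SigmaFinite (μ i)]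
    {f : ∀ i, E i → ℝ} (hf : ∀ i, Integrable (f i) (μ i)) (hf0 : ∀ i x, 0 ≤ f i x) :
    ∫⁻ x, ENNReal.ofReal (∏ i, f i (x i)) ∂(Measure.pi μ)
      = ∏ i, ∫⁻ x, ENNReal.ofReal (f i x) ∂(μ i) := by
  rw [← ofReal_integral_eq_lintegral_ofReal (Integrable.fintype_prod_dep hf)
    (ae_of_all _ fun x => Finset.prod_nonneg fun i _ => hf0 i _), integral_fintype_prod_eq_prod,
    ENNReal.ofReal_prod_of_nonneg fun i _ => integral_nonneg (hf0 i)]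
  exact Finset.prod_congr rfl fun i _ =>
    ofReal_integral_eq_lintegral_ofReal (hf i) (ae_of_all _ (hf0 i))

theorem pi_withDensity_ofReal {ι : Type*} [Fintype ι] {E : ι → Type*}
    [∀ i, MeasurableSpace (E i)] (μ : ∀ i, Measure (E i)) [∀ i, SigmaFinite (μ i)]
    {f : ∀ i, E i → ℝ} (hf : ∀ i, Integrable (f i) (μ i)) (hf0 : ∀ i x, 0 ≤ f i x) :
    Measure.pi (fun i => (μ i).withDensity fun x => ENNReal.ofReal (f i x))
      = (Measure.pi μ).withDensity fun x => ENNReal.ofReal (∏ i, f i (x i)) := by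
  have hfin : ∀ i, IsFiniteMeasure ((μ i).withDensity fun x => ENNReal.ofReal (f i x)) :=
    fun i => isFiniteMeasure_withDensity_ofReal (hf i).2
  refine Measure.pi_eq fun s hs => ?_
  rw [withDensity_apply _ (MeasurableSet.univ_pi hs)]
  simp_rw [withDensity_apply _ (hs _)]
  rw [Measure.restrict_pi_pi]
  exact lintegral_pi_prod_ofReal _ (fun i => (hf i).restrict) hf0

theorem integral_comp_measurePreserving {μ : Measure X} {ν : Measure Y} {f : X → Y}
    (hf : MeasurePreserving f μ ν) {g : Y → ℝ} (hg : AEStronglyMeasurable g ν) :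
    ∫ x, g (f x) ∂μ = ∫ y, g y ∂ν := by
  rw [← hf.map_eq, integral_map hf.measurable.aemeasurable (by rwa [hf.map_eq])]

theorem map_eval_pair_pi {ι : Type*} [Fintype ι] (μ : Measure X) [IsProbabilityMeasure μ]
    {i j : ι} (hij : i ≠ j) :
    (Measure.pi fun _ : ι => μ).map (fun c => (c i, c j)) = μ.prod μ := by
  have h : IndepFun (fun c : ι → X => c i) (fun c => c j) (Measure.pi fun _ : ι => μ) :=
    (iIndepFun_pi (μ := fun _ : ι => μ) (X := fun _ => id) fun _ => aemeasurable_id).indepFun hij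
  have he : ∀ k : ι, (Measure.pi fun _ : ι => μ).map (fun c => c k) = μ := fun k =>
    (measurePreserving_eval (fun _ : ι => μ) k).map_eq
  rw [indepFun_iff_map_prod_eq_prod_map_map (measurable_pi_apply i).aemeasurable
    (measurable_pi_apply j).aemeasurable, he, he] at h
  exact h

theorem integrable_withDensity_ofReal_iff {ν : Measure Y} {r : Y → ℝ} (hr : Measurable r)
    (hr0 : ∀ y, 0 ≤ r y) {f : Y → ℝ} :
    Integrable f (ν.withDensity fun y => ENNReal.ofReal (r y))
      ↔ Integrable (fun y => r y * f y) ν := by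
  rw [integrable_withDensity_iff_integrable_smul' (by fun_prop) (by simp)]
  simp [ENNReal.toReal_ofReal (hr0 _)]

theorem integral_withDensity_ofReal {ν : Measure Y} {r : Y → ℝ} (hr : Measurable r)
    (hr0 : ∀ y, 0 ≤ r y) (f : Y → ℝ) :
    ∫ y, f y ∂(ν.withDensity fun y => ENNReal.ofReal (r y)) = ∫ y, r y * f y ∂ν := by
  rw [integral_withDensity_eq_integral_toReal_smul (by fun_prop) (by simp)]
  simp [ENNReal.toReal_ofReal (hr0 _)]

/-- The Donsker–Varadhan inequality, integrability included, for a function bounded below. -/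
theorem integrable_and_integral_le_klDiv_add_log {ν η : Measure Y} [IsProbabilityMeasure ν]
    [IsProbabilityMeasure η] (hkl : InformationTheory.klDiv η ν ≠ ∞) {f : Y → ℝ}
    (hf : Measurable f) {a : ℝ} (hfa : ∀ᵐ y ∂η, a ≤ f y)
    (hexp : Integrable (fun y => Real.exp (f y)) ν) :
    Integrable f η ∧
      ∫ y, f y ∂η ≤ (InformationTheory.klDiv η ν).toReal + Real.log (∫ y, Real.exp (f y) ∂ν) := by
  obtain ⟨hac, hllr⟩ := InformationTheory.klDiv_ne_top_iff.1 hkl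
  have hI : 0 < ∫ y, Real.exp (f y) ∂ν := integral_exp_pos hexp
  set c := Real.log (∫ y, Real.exp (f y) ∂ν) with hc
  have hlin : ∫⁻ y, ENNReal.ofReal (Real.exp (f y - llr η ν y)) ∂η
      ≤ ∫⁻ y, ENNReal.ofReal (Real.exp (f y)) ∂ν := by
    rw [← lintegral_rnDeriv_mul hac (by fun_prop)]
    refine lintegral_mono_ae ?_
    filter_upwards [η.rnDeriv_lt_top ν] with y hy
    rcases eq_or_ne (η.rnDeriv ν y) 0 with h0 | h0
    · simp [h0]
    · have hpos : 0 < (η.rnDeriv ν y).toReal := ENNReal.toReal_pos h0 hy.ne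
      rw [llr, Real.exp_sub, Real.exp_log hpos]
      nth_rw 1 [← ENNReal.ofReal_toReal hy.ne]
      rw [← ENNReal.ofReal_mul hpos.le, mul_div_cancel₀ _ hpos.ne']
  have hint : Integrable (fun y => Real.exp (f y - llr η ν y)) η := by
    have hm : Measurable fun y => Real.exp (f y - llr η ν y) := (hf.sub (measurable_llr η ν)).exp
    rw [← lintegral_ofReal_ne_top_iff_integrable hm.aestronglyMeasurable
      (ae_of_all _ fun _ => (Real.exp_pos _).le)]
    exact (hlin.trans_lt hexp.lintegral_lt_top).ne
  have hle : ∫ y, Real.exp (f y - llr η ν y) ∂η ≤ ∫ y, Real.exp (f y) ∂ν := by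
    rw [integral_eq_lintegral_of_nonneg_ae (ae_of_all _ fun _ => (Real.exp_pos _).le) hint.1,
      integral_eq_lintegral_of_nonneg_ae (ae_of_all _ fun _ => (Real.exp_pos _).le) hexp.1]
    exact ENNReal.toReal_mono hexp.lintegral_lt_top.ne hlin
  -- No moment of `f` under `η` is assumed: `f` is bounded below by `a` and above by `llr + exp (f -
  -- llr)`, both integrable.
  have hfint : Integrable f η := by
    refine Integrable.mono' (g := fun y => |a| + (|llr η ν y| + Real.exp (f y - llr η ν y)))
      ((integrable_const _).add (hllr.abs.add hint)) hf.aestronglyMeasurable ?_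
    filter_upwards [hfa] with y hy
    rw [Real.norm_eq_abs, abs_le]
    have h1 := Real.add_one_le_exp (f y - llr η ν y)
    have h2 := le_abs_self (llr η ν y)
    have h3 := neg_abs_le a
    have h4 := abs_nonneg a
    have h5 := abs_nonneg (llr η ν y)
    have h6 := Real.exp_pos (f y - llr η ν y)
    constructor <;> linarith
  refine ⟨hfint, ?_⟩
  have hkl' : (InformationTheory.klDiv η ν).toReal = ∫ y, llr η ν y ∂η := by
    rw [InformationTheory.toReal_klDiv_of_measure_eq hac (by simp)]
  rw [hkl']
  have hs1 : Integrable (fun y => f y - llr η ν y) η := hfint.sub hllr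
  have hs2 : Integrable (fun y => f y - llr η ν y - c) η := hs1.sub (integrable_const _)
  -- Jensen's inequality in linearised form, `1 + x ≤ exp x`, with `c` the normalisation that makes
  -- the right side integrate to at most one.
  have hmono : ∫ y, (f y - llr η ν y - c + 1) ∂η
      ≤ ∫ y, Real.exp (-c) * Real.exp (f y - llr η ν y) ∂η := by
    refine integral_mono (hs2.add (integrable_const _))
      (hint.const_mul _) fun y => ?_
    have := Real.add_one_le_exp (-c + (f y - llr η ν y))
    rw [Real.exp_add] at this
    dsimp only
    linarith
  rw [integral_const_mul, integral_add hs2 (integrable_const _),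
    integral_sub hs1 (integrable_const _),
    integral_sub hfint hllr] at hmono
  have h1 : Real.exp (-c) * ∫ y, Real.exp (f y - llr η ν y) ∂η ≤ 1 := by
    rw [Real.exp_neg, hc, Real.exp_log hI]
    calc _ ≤ (∫ y, Real.exp (f y) ∂ν)⁻¹ * ∫ y, Real.exp (f y) ∂ν := by gcongr
      _ = 1 := inv_mul_cancel₀ hI.ne'
  simp only [integral_const, probReal_univ, smul_eq_mul, one_mul] at hmono
  linarith

/-- A change-of-measure bound on the probability of an event under a density `r` by its
probability under a density `w`. -/
theorem log_mul_measureReal_le {ν : Measure Y} {r w : Y → ℝ} (hr : Measurable r)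
    (hr0 : ∀ y, 0 ≤ r y) (hw : Measurable w) (hw0 : ∀ y, 0 < w y)
    (hrP : IsProbabilityMeasure (ν.withDensity fun y => ENNReal.ofReal (r y)))
    (hwP : IsProbabilityMeasure (ν.withDensity fun y => ENNReal.ofReal (w y)))
    (hlr : Integrable (fun y => Real.log (r y) - Real.log (w y))
      (ν.withDensity fun y => ENNReal.ofReal (r y)))
    {D : Set Y} (hD : MeasurableSet D) {M : ℝ} (hM : 1 ≤ M) :
    Real.log M * (ν.withDensity fun y => ENNReal.ofReal (r y)).real D
      ≤ ∫ y, (Real.log (r y) - Real.log (w y)) ∂(ν.withDensity fun y => ENNReal.ofReal (r y))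
        + M * (ν.withDensity fun y => ENNReal.ofReal (w y)).real D := by
  have hw0' : ∀ y, 0 ≤ w y := fun y => (hw0 y).le
  have hri : Integrable r ν := by
    simpa using (integrable_withDensity_ofReal_iff (ν := ν) hr hr0 (f := fun _ => 1)).1
      (integrable_const _)
  have hwi : Integrable w ν := by
    simpa using (integrable_withDensity_ofReal_iff (ν := ν) hw hw0' (f := fun _ => 1)).1
      (integrable_const _)
  have hr1 : ∫ y, r y ∂ν = 1 := by
    have := integral_withDensity_ofReal (ν := ν) hr hr0 fun _ => 1
    simpa using this.symm
  have hw1 : ∫ y, w y ∂ν = 1 := by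
    have := integral_withDensity_ofReal (ν := ν) hw hw0' fun _ => 1
    simpa using this.symm
  have hind : ∀ u : Y → ℝ, Measurable u → (∀ y, 0 ≤ u y) →
      IsFiniteMeasure (ν.withDensity fun y => ENNReal.ofReal (u y)) →
      Integrable (fun y => u y * D.indicator 1 y) ν ∧
      (ν.withDensity fun y => ENNReal.ofReal (u y)).real D = ∫ y, u y * D.indicator 1 y ∂ν := by
    intro u hu hu0 hfin
    refine ⟨(integrable_withDensity_ofReal_iff hu hu0).1 ((integrable_indicator_iff hD).2
      (integrable_const _).integrableOn), ?_⟩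
    rw [← integral_withDensity_ofReal hu hu0, integral_indicator_one hD]
  obtain ⟨hi1, he1⟩ := hind r hr hr0 inferInstance
  obtain ⟨hi2, he2⟩ := hind w hw hw0' inferInstance
  have hlr' := (integrable_withDensity_ofReal_iff hr hr0).1 hlr
  rw [he1, he2, integral_withDensity_ofReal hr hr0, ← integral_const_mul, ← integral_const_mul]
  have hs : Integrable (fun y => r y * (Real.log (r y) - Real.log (w y))
      + M * (w y * D.indicator 1 y)) ν := hlr'.add (hi2.const_mul _)
  -- The extra summands `r` and `w` both have integral one and cancel. Pointwise the inequality is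
  -- `log x ≤ x - 1` at `x = M w / r` on `D` and at `x = w / r` off `D`.
  have key : ∫ y, (Real.log M * (r y * D.indicator 1 y) + r y) ∂ν
      ≤ ∫ y, (r y * (Real.log (r y) - Real.log (w y)) + M * (w y * D.indicator 1 y) + w y) ∂ν := by
    refine integral_mono ((hi1.const_mul _).add hri) (hs.add hwi)
      fun y => ?_
    dsimp only
    have hwy := hw0 y
    rcases (hr0 y).eq_or_lt with h0 | h0
    · rw [← h0]
      have : 0 ≤ M * (w y * D.indicator 1 y) := by
        refine mul_nonneg (by linarith) (mul_nonneg hwy.le ?_)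
        exact Set.indicator_nonneg (fun _ _ => zero_le_one) _
      simp only [zero_mul, mul_zero, zero_add, add_zero]
      linarith
    · by_cases hy : y ∈ D
      · simp only [Set.indicator_of_mem hy, Pi.one_apply, mul_one]
        have h1 := Real.log_le_sub_one_of_pos (x := M * w y / r y) (by positivity)
        rw [Real.log_div (by positivity) h0.ne', Real.log_mul (by positivity) hwy.ne'] at h1
        have h2 := mul_le_mul_of_nonneg_left h1 h0.le
        have h3 : r y * (M * w y / r y - 1) = M * w y - r y := by field_simp
        rw [h3] at h2
        nlinarith
      · simp only [Set.indicator_of_notMem hy, mul_zero, zero_add, add_zero]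
        have h1 := Real.log_le_sub_one_of_pos (x := w y / r y) (by positivity)
        rw [Real.log_div hwy.ne' h0.ne'] at h1
        have h2 := mul_le_mul_of_nonneg_left h1 h0.le
        have h3 : r y * (w y / r y - 1) = w y - r y := by field_simp
        rw [h3] at h2
        nlinarith
  rw [integral_add (hi1.const_mul _) hri, integral_add hs hwi,
    integral_add hlr' (hi2.const_mul _), hr1, hw1] at key
  linarith

end General

/-! ### Random codebooks and the divergence of their output law -/

section RandomCoding

variable {X Y : Type*} [MeasurableSpace X] [MeasurableSpace Y]

/-- `r x` is the output density of a channel at the input `x`, with respect to the measure `ν`;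
`w` is the output density for the input law `μ`, and the mutual information is finite. -/
structure IsChannelDensity (μ : Measure X) (ν : Measure Y) (r : X → Y → ℝ) (w : Y → ℝ) : Prop where
  measurable_r : Measurable fun q : X × Y => r q.1 q.2
  nonneg : ∀ x y, 0 ≤ r x y
  measurable_w : Measurable w
  pos : ∀ y, 0 < w y
  lintegral_output : ∀ᵐ x ∂μ, ∫⁻ y, ENNReal.ofReal (r x y) ∂ν = 1
  lintegral_input : ∀ᵐ y ∂ν, ∫⁻ x, ENNReal.ofReal (r x y) ∂μ = ENNReal.ofReal (w y)
  integrable_mul_log : Integrable (fun q : X × Y => r q.1 q.2 * Real.log (r q.1 q.2)) (μ.prod ν)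
  integrable_mul_log_output :
    Integrable (fun q : X × Y => r q.1 q.2 * Real.log (w q.2)) (μ.prod ν)

namespace IsChannelDensity

variable {μ : Measure X} {ν : Measure Y} [IsProbabilityMeasure μ] [IsProbabilityMeasure ν]
  {r : X → Y → ℝ} {w : Y → ℝ}

theorem lintegral_prod_eq_one (h : IsChannelDensity μ ν r w) :
    ∫⁻ q, ENNReal.ofReal (r q.1 q.2) ∂(μ.prod ν) = 1 := by
  rw [lintegral_prod _ h.measurable_r.ennreal_ofReal.aemeasurable,
    lintegral_congr_ae h.lintegral_output]
  simp

theorem integrable (h : IsChannelDensity μ ν r w) :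
    Integrable (fun q : X × Y => r q.1 q.2) (μ.prod ν) := by
  rw [← lintegral_ofReal_ne_top_iff_integrable h.measurable_r.aestronglyMeasurable
    (ae_of_all _ fun q => h.nonneg _ _), h.lintegral_prod_eq_one]
  simp

theorem integral_eq_one (h : IsChannelDensity μ ν r w) :
    ∫ q, r q.1 q.2 ∂(μ.prod ν) = 1 := by
  rw [integral_eq_lintegral_of_nonneg_ae (ae_of_all _ fun q => h.nonneg _ _)
    h.measurable_r.aestronglyMeasurable, h.lintegral_prod_eq_one]
  simp

theorem lintegral_output_eq_one (h : IsChannelDensity μ ν r w) :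
    ∫⁻ y, ENNReal.ofReal (w y) ∂ν = 1 := by
  rw [← h.lintegral_prod_eq_one, lintegral_prod_symm _ h.measurable_r.ennreal_ofReal.aemeasurable]
  exact lintegral_congr_ae (h.lintegral_input.mono fun y hy => hy.symm)

theorem integrable_output (h : IsChannelDensity μ ν r w) :
    Integrable (fun q : X × Y => w q.2) (μ.prod ν) := by
  have hw : Integrable w ν := by
    rw [← lintegral_ofReal_ne_top_iff_integrable h.measurable_w.aestronglyMeasurable
      (ae_of_all _ fun y => (h.pos y).le), h.lintegral_output_eq_one]
    simp
  exact hw.comp_snd μ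

variable {J : Type*} [Fintype J]

/-- Distinct codewords are independent, so for fixed `y` the factor of codeword `j` averages out to
the output density `w y`. -/
theorem lintegral_codebook_pair (h : IsChannelDensity μ ν r w) {i j : J} (hij : i ≠ j)
    {u : X → Y → ℝ≥0∞} (hu : Measurable fun q : X × Y => u q.1 q.2) :
    ∫⁻ q, u (q.1 i) q.2 * ENNReal.ofReal (r (q.1 j) q.2) ∂((Measure.pi fun _ : J => μ).prod ν)
      = ∫⁻ q, u q.1 q.2 * ENNReal.ofReal (w q.2) ∂(μ.prod ν) := by
  have hr := h.measurable_r
  have hw := h.measurable_w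
  have hmp : MeasurePreserving (fun c : J → X => (c i, c j)) (Measure.pi fun _ : J => μ)
      (μ.prod μ) :=
    ⟨(measurable_pi_apply i).prodMk (measurable_pi_apply j), map_eval_pair_pi μ hij⟩
  have hmp' := hmp.prod (MeasurePreserving.id ν)
  have hu' : Measurable fun q : (X × X) × Y => u q.1.1 q.2 :=
    hu.comp ((measurable_fst.comp measurable_fst).prodMk measurable_snd)
  have hr' : Measurable fun q : (X × X) × Y => r q.1.2 q.2 :=
    hr.comp ((measurable_snd.comp measurable_fst).prodMk measurable_snd)
  have hm1 : Measurable fun q : (X × X) × Y => u q.1.1 q.2 * ENNReal.ofReal (r q.1.2 q.2) :=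
    hu'.mul hr'.ennreal_ofReal
  have hm2 : Measurable fun q : X × Y => u q.1 q.2 * ENNReal.ofReal (w q.2) :=
    hu.mul (hw.comp measurable_snd).ennreal_ofReal
  have h1 := hmp'.lintegral_comp (f := fun q : (X × X) × Y =>
    u q.1.1 q.2 * ENNReal.ofReal (r q.1.2 q.2)) hm1
  refine h1.trans ?_
  rw [lintegral_prod_symm _ hm1.aemeasurable, lintegral_prod_symm _ hm2.aemeasurable]
  refine lintegral_congr_ae ?_
  filter_upwards [h.lintegral_input] with y hy
  have hry : Measurable fun x => r x y := hr.comp (measurable_id.prodMk measurable_const)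
  have huy : Measurable fun x => u x y := hu.comp (measurable_id.prodMk measurable_const)
  rw [lintegral_prod_mul (f := fun x => u x y) huy.aemeasurable hry.ennreal_ofReal.aemeasurable,
    hy, lintegral_mul_const _ huy]

theorem lintegral_codebook_single {j : J} {u : X → Y → ℝ≥0∞}
    (hu : Measurable fun q : X × Y => u q.1 q.2) :
    ∫⁻ q, u (q.1 j) q.2 ∂((Measure.pi fun _ : J => μ).prod ν) = ∫⁻ q, u q.1 q.2 ∂(μ.prod ν) :=
  ((measurePreserving_eval (fun _ : J => μ) j).prod (MeasurePreserving.id ν)).lintegral_comp hu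

theorem measurePreserving_codebook_single (μ : Measure X) (ν : Measure Y)
    [IsProbabilityMeasure μ] [IsProbabilityMeasure ν] (j : J) :
    MeasurePreserving (fun q : (J → X) × Y => (q.1 j, q.2)) ((Measure.pi fun _ : J => μ).prod ν)
      (μ.prod ν) :=
  (measurePreserving_eval (fun _ : J => μ) j).prod (MeasurePreserving.id ν)

theorem integral_codebook_single (j : J) {u : X × Y → ℝ} (hu : Integrable u (μ.prod ν)) :
    Integrable (fun q : (J → X) × Y => u (q.1 j, q.2)) ((Measure.pi fun _ : J => μ).prod ν) ∧
    ∫ q, u (q.1 j, q.2) ∂((Measure.pi fun _ : J => μ).prod ν) = ∫ q, u q ∂(μ.prod ν) := by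
  have hmp := measurePreserving_codebook_single μ ν j
  exact ⟨hmp.integrable_comp_of_integrable hu, integral_comp_measurePreserving hmp hu.1⟩

theorem integral_codebook_pair (h : IsChannelDensity μ ν r w) {i j : J} (hij : i ≠ j)
    {u : X → Y → ℝ} (hu : Measurable fun q : X × Y => u q.1 q.2) (hu0 : ∀ x y, 0 ≤ u x y) {B : ℝ}
    (huB : ∀ x y, u x y ≤ B) :
    Integrable (fun q : (J → X) × Y => u (q.1 i) q.2 * r (q.1 j) q.2)
      ((Measure.pi fun _ : J => μ).prod ν) ∧
    ∫ q, u (q.1 i) q.2 * r (q.1 j) q.2 ∂((Measure.pi fun _ : J => μ).prod ν)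
      = ∫ q, u q.1 q.2 * w q.2 ∂(μ.prod ν) := by
  have hui : Measurable fun q : (J → X) × Y => u (q.1 i) q.2 :=
    hu.comp (measurePreserving_codebook_single μ ν i).measurable
  have hrj : Measurable fun q : (J → X) × Y => r (q.1 j) q.2 :=
    h.measurable_r.comp (measurePreserving_codebook_single μ ν j).measurable
  have hw : Measurable fun q : X × Y => w q.2 := h.measurable_w.comp measurable_snd
  constructor
  · exact (integral_codebook_single j h.integrable).1.bdd_mul (c := B) hui.aestronglyMeasurable
      (ae_of_all _ fun q => by simpa [abs_of_nonneg (hu0 _ _)] using huB _ _)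
  · rw [integral_eq_lintegral_of_nonneg_ae
        (ae_of_all _ fun q => mul_nonneg (hu0 _ _) (h.nonneg _ _))
        (hui.mul hrj).aestronglyMeasurable,
      integral_eq_lintegral_of_nonneg_ae
        (ae_of_all _ fun q => mul_nonneg (hu0 _ _) (h.pos _).le)
        (hu.mul hw).aestronglyMeasurable]
    simp_rw [ENNReal.ofReal_mul (hu0 _ _)]
    rw [h.lintegral_codebook_pair hij (u := fun x y => ENNReal.ofReal (u x y)) hu.ennreal_ofReal]

/-- A majorant independent of `N`, for dominated convergence: `r / N + w` lies between `w` and twice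
the maximum of `r` and `w`. -/
theorem norm_mul_log_le {r w N : ℝ} (hr : 0 ≤ r) (hw : 0 < w) (hN : 1 ≤ N) :
    ‖r * Real.log (r / N + w)‖ ≤
      Real.log 2 * r + (‖r * Real.log r‖ + ‖r * Real.log w‖) := by
  rw [norm_mul, norm_mul, norm_mul, Real.norm_of_nonneg hr]
  suffices h : 0 < r → |Real.log (r / N + w)| ≤ Real.log 2 + (|Real.log r| + |Real.log w|) by
    rcases hr.eq_or_lt with h0 | h0
    · simp [← h0]
    · have := mul_le_mul_of_nonneg_left (h h0) hr
      simp only [Real.norm_eq_abs]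
      linarith
  intro h0
  have hrN : r / N ≤ r := div_le_self hr hN
  have hrN0 : 0 ≤ r / N := by positivity
  have hl2 : 0 ≤ Real.log 2 := Real.log_nonneg (by norm_num)
  have h1 := neg_abs_le (Real.log w)
  have h2 := abs_nonneg (Real.log r)
  have h3 := abs_nonneg (Real.log w)
  have h4 := le_abs_self (Real.log r)
  have h5 := le_abs_self (Real.log w)
  rw [abs_le]
  constructor
  · have := Real.log_le_log hw (by linarith : w ≤ r / N + w)
    linarith
  · rcases le_total r w with hrw | hrw
    · have := Real.log_le_log (by positivity) (by linarith : r / N + w ≤ 2 * w)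
      rw [Real.log_mul (by norm_num) hw.ne'] at this
      linarith
    · have := Real.log_le_log (by positivity) (by linarith : r / N + w ≤ 2 * r)
      rw [Real.log_mul (by norm_num) h0.ne'] at this
      linarith

theorem measurable_mul_log {μ : Measure X} {ν : Measure Y} (h : IsChannelDensity μ ν r w) (N : ℝ) :
    Measurable fun q : X × Y => r q.1 q.2 * Real.log (r q.1 q.2 / N + w q.2) :=
  h.measurable_r.mul ((h.measurable_r.div_const N).add (h.measurable_w.comp measurable_snd)).log

theorem integrable_dominating (h : IsChannelDensity μ ν r w) :
    Integrable (fun q : X × Y => Real.log 2 * r q.1 q.2 + (‖r q.1 q.2 * Real.log (r q.1 q.2)‖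
      + ‖r q.1 q.2 * Real.log (w q.2)‖)) (μ.prod ν) :=
  (h.integrable.const_mul _).add (h.integrable_mul_log.norm.add h.integrable_mul_log_output.norm)

theorem integrable_mul_log_add (h : IsChannelDensity μ ν r w) {N : ℝ} (hN : 1 ≤ N) :
    Integrable (fun q : X × Y => r q.1 q.2 * Real.log (r q.1 q.2 / N + w q.2)) (μ.prod ν) :=
  h.integrable_dominating.mono' (h.measurable_mul_log N).aestronglyMeasurable
    (ae_of_all _ fun _ => norm_mul_log_le (h.nonneg _ _) (h.pos _) hN)

/-- The limit is the divergence of the ideal output law `w` from `ν`; the excess caused by a finite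
codebook dies as the codebook grows, without any rate being needed. -/
theorem tendsto_integral_mul_log_add (h : IsChannelDensity μ ν r w) :
    Tendsto (fun N : ℕ => ∫ q, r q.1 q.2 * Real.log (r q.1 q.2 / N + w q.2) ∂(μ.prod ν)) atTop
      (𝓝 (∫ q, r q.1 q.2 * Real.log (w q.2) ∂(μ.prod ν))) := by
  refine tendsto_integral_filter_of_dominated_convergence _ (Eventually.of_forall fun N : ℕ =>
    (h.measurable_mul_log N).aestronglyMeasurable) ?_ h.integrable_dominating
    (ae_of_all _ fun q => ?_)
  · filter_upwards [eventually_ge_atTop 1] with N hN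
    exact ae_of_all _ fun q => norm_mul_log_le (h.nonneg _ _) (h.pos _) (by exact_mod_cast hN)
  · have h1 : Tendsto (fun N : ℕ => r q.1 q.2 / N + w q.2) atTop (𝓝 (0 + w q.2)) :=
      (tendsto_const_div_atTop_nhds_zero_nat _).add_const _
    rw [zero_add] at h1
    exact (h1.log (h.pos _).ne').const_mul _

/-- A pointwise bound on the divergence integrand of a codebook average. -/
theorem klFun_average_le [Nonempty J] {ρ : J → ℝ} (hρ : ∀ j, 0 ≤ ρ j) {w : ℝ} (hw : 0 < w) :
    InformationTheory.klFun ((Fintype.card J : ℝ)⁻¹ * ∑ j, ρ j) ≤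
      ∑ j, (Fintype.card J : ℝ)⁻¹ * (ρ j * Real.log (ρ j / Fintype.card J + w)
        + (Fintype.card J : ℝ)⁻¹ * ∑ i, ρ j / (ρ j / Fintype.card J + w) * ρ i + 1 - 2 * ρ j) := by
  have hN : (0 : ℝ) < Fintype.card J := by exact_mod_cast Fintype.card_pos
  set N : ℝ := (Fintype.card J : ℝ) with hNdef
  set g := N⁻¹ * ∑ j, ρ j with hg
  have hg0 : 0 ≤ g := mul_nonneg (by positivity) (Finset.sum_nonneg fun j _ => hρ j)
  have h1 : InformationTheory.klFun g = ∑ j, N⁻¹ * (ρ j * Real.log g + 1 - ρ j) := by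
    rw [← Finset.mul_sum, Finset.sum_sub_distrib, Finset.sum_add_distrib, ← Finset.sum_mul,
      InformationTheory.klFun_apply]
    simp only [Finset.sum_const, Finset.card_univ, nsmul_eq_mul, mul_one]
    rw [← hNdef, mul_sub, mul_add, inv_mul_cancel₀ hN.ne', ← mul_assoc]
  rw [h1]
  refine Finset.sum_le_sum fun j _ => mul_le_mul_of_nonneg_left ?_ (by positivity)
  rw [← Finset.mul_sum, mul_left_comm, ← hg]
  rcases (hρ j).eq_or_lt with h0 | h0
  · simp [← h0]
  have ha : 0 < ρ j / N + w := by positivity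
  have hgp : 0 < g := by
    have : 0 < ∑ i, ρ i := h0.trans_le (Finset.single_le_sum (fun i _ => hρ i) (Finset.mem_univ j))
    positivity
  -- The logarithm is linearised at `ρ j / N + w`, approximately the conditional mean of the
  -- codebook average given codeword `j`. This replaces a conditional Jensen inequality.
  have h2 := Real.log_le_sub_one_of_pos (x := g / (ρ j / N + w)) (by positivity)
  rw [Real.log_div hgp.ne' ha.ne'] at h2
  have h3 := mul_le_mul_of_nonneg_left h2 h0.le
  have h4 : ρ j * (g / (ρ j / N + w) - 1) = ρ j / (ρ j / N + w) * g - ρ j := by ring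
  rw [h4] at h3
  linarith

/-- The expected divergence of the output law of a random codebook. -/
theorem lintegral_klFun_codebook_le [Nonempty J] (h : IsChannelDensity μ ν r w) :
    ∫⁻ q, ENNReal.ofReal (InformationTheory.klFun ((Fintype.card J : ℝ)⁻¹ * ∑ j, r (q.1 j) q.2))
        ∂((Measure.pi fun _ : J => μ).prod ν)
      ≤ ENNReal.ofReal
        (∫ q, r q.1 q.2 * Real.log (r q.1 q.2 / Fintype.card J + w q.2) ∂(μ.prod ν)) := by
  classical
  have hN1 : (1 : ℝ) ≤ Fintype.card J := by exact_mod_cast Fintype.card_pos (α := J)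
  set N : ℝ := (Fintype.card J : ℝ) with hNdef
  have hN : 0 < N := by linarith
  set u : X → Y → ℝ := fun x y => r x y / (r x y / N + w y) with hu
  have hden : ∀ x y, 0 < r x y / N + w y := fun x y =>
    add_pos_of_nonneg_of_pos (div_nonneg (h.nonneg _ _) hN.le) (h.pos y)
  have hum : Measurable fun q : X × Y => u q.1 q.2 :=
    h.measurable_r.div ((h.measurable_r.div_const N).add (h.measurable_w.comp measurable_snd))
  have hu0 : ∀ x y, 0 ≤ u x y := fun x y => div_nonneg (h.nonneg _ _) (hden x y).le
  have huN : ∀ x y, u x y ≤ N := fun x y => by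
    rw [hu, div_le_iff₀ (hden x y), mul_add, mul_div_cancel₀ _ hN.ne']
    have := mul_pos hN (h.pos y)
    linarith
  -- This identity makes the linear correction harmless. Codeword `j` paired with itself contributes
  -- the first summand, the other codewords together at most the second, so the correction has
  -- expectation at most `∫ r = 1`.
  have hsplit : ∀ x y, N⁻¹ * (u x y * r x y) + u x y * w y = r x y := fun x y => by
    have hd := (hden x y).ne'
    simp only [hu]
    rw [show ∀ a : ℝ, N⁻¹ * (r x y / a * r x y) + r x y / a * w y = r x y * (r x y / N + w y) / a
      from fun a => by ring, mul_div_cancel_right₀ _ hd]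
  set m := (Measure.pi fun _ : J => μ).prod ν with hm
  have hurI : Integrable (fun q : X × Y => u q.1 q.2 * r q.1 q.2) (μ.prod ν) :=
    h.integrable.bdd_mul (c := N) hum.aestronglyMeasurable
      (ae_of_all _ fun q => by simpa [abs_of_nonneg (hu0 _ _)] using huN _ _)
  have huwI : Integrable (fun q : X × Y => u q.1 q.2 * w q.2) (μ.prod ν) :=
    h.integrable_output.bdd_mul (c := N) hum.aestronglyMeasurable
      (ae_of_all _ fun q => by simpa [abs_of_nonneg (hu0 _ _)] using huN _ _)
  have hF := fun j : J => integral_codebook_single j (h.integrable_mul_log_add hN1)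
  have hR := fun j : J => integral_codebook_single j h.integrable
  have hT : ∀ i j : J, Integrable (fun q : (J → X) × Y => u (q.1 j) q.2 * r (q.1 i) q.2) m ∧
      ∫ q, u (q.1 j) q.2 * r (q.1 i) q.2 ∂m = if i = j then
        ∫ q, u q.1 q.2 * r q.1 q.2 ∂(μ.prod ν) else ∫ q, u q.1 q.2 * w q.2 ∂(μ.prod ν) := by
    intro i j
    split_ifs with hij
    · subst hij
      exact integral_codebook_single i hurI
    · exact h.integral_codebook_pair (fun hji => hij hji.symm) hum hu0 huN
  have hS : ∀ j : J, Integrable (fun q : (J → X) × Y => N⁻¹ * ∑ i, u (q.1 j) q.2 * r (q.1 i) q.2) m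
      ∧ ∫ q, N⁻¹ * ∑ i, u (q.1 j) q.2 * r (q.1 i) q.2 ∂m ≤ 1 := by
    intro j
    refine ⟨(integrable_finsetSum _ fun i _ => (hT i j).1).const_mul _, ?_⟩
    rw [integral_const_mul, integral_finsetSum _ fun i _ => (hT i j).1]
    simp_rw [(hT _ j).2]
    rw [Finset.sum_ite, Finset.sum_const, Finset.sum_const, Finset.filter_eq' Finset.univ j]
    simp only [Finset.mem_univ, if_true, Finset.card_singleton, one_smul, nsmul_eq_mul]
    have hcard : ((Finset.univ.filter fun i => ¬ i = j).card : ℝ) ≤ N := by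
      rw [hNdef]
      exact_mod_cast Finset.card_le_univ _
    have huw0 : 0 ≤ ∫ q, u q.1 q.2 * w q.2 ∂(μ.prod ν) :=
      integral_nonneg fun q => mul_nonneg (hu0 _ _) (h.pos _).le
    calc _ ≤ N⁻¹ * (∫ q, u q.1 q.2 * r q.1 q.2 ∂(μ.prod ν)
          + N * ∫ q, u q.1 q.2 * w q.2 ∂(μ.prod ν)) := by gcongr
      _ = ∫ q, (N⁻¹ * (u q.1 q.2 * r q.1 q.2) + u q.1 q.2 * w q.2) ∂(μ.prod ν) := by
        rw [integral_add (hurI.const_mul _) huwI, integral_const_mul, mul_add,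
          inv_mul_cancel_left₀ hN.ne']
      _ = 1 := by simp_rw [hsplit]; exact h.integral_eq_one
      _ ≤ 1 := le_rfl
  set F : X → Y → ℝ := fun x y => r x y * Real.log (r x y / N + w y) with hFdef
  have hterm : ∀ j : J, Integrable (fun q : (J → X) × Y => N⁻¹ * (F (q.1 j) q.2
        + N⁻¹ * ∑ i, u (q.1 j) q.2 * r (q.1 i) q.2 + 1 - 2 * r (q.1 j) q.2)) m ∧
      ∫ q, N⁻¹ * (F (q.1 j) q.2
        + N⁻¹ * ∑ i, u (q.1 j) q.2 * r (q.1 i) q.2 + 1 - 2 * r (q.1 j) q.2) ∂m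
      ≤ N⁻¹ * ∫ q, F q.1 q.2 ∂(μ.prod ν) := by
    intro j
    have i1 : Integrable (fun q : (J → X) × Y => F (q.1 j) q.2) m := (hF j).1
    have i2 : Integrable (fun q : (J → X) × Y => r (q.1 j) q.2) m := (hR j).1
    have i3 : Integrable (fun q : (J → X) × Y => F (q.1 j) q.2
        + N⁻¹ * ∑ i, u (q.1 j) q.2 * r (q.1 i) q.2) m := i1.add (hS j).1
    have i4 : Integrable (fun q : (J → X) × Y => F (q.1 j) q.2
        + N⁻¹ * ∑ i, u (q.1 j) q.2 * r (q.1 i) q.2 + 1) m := i3.add (integrable_const _)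
    refine ⟨(i4.sub (i2.const_mul 2)).const_mul _, ?_⟩
    rw [integral_const_mul, integral_sub i4 (i2.const_mul 2), integral_add i3 (integrable_const _),
      integral_add i1 (hS j).1, integral_const_mul 2]
    have e1 : ∫ q, F (q.1 j) q.2 ∂m = ∫ q, F q.1 q.2 ∂(μ.prod ν) := (hF j).2
    have e2 : ∫ q, r (q.1 j) q.2 ∂m = 1 := (hR j).2.trans h.integral_eq_one
    rw [e1, e2, integral_const, probReal_univ]
    have := (hS j).2
    gcongr
    simp only [smul_eq_mul, mul_one]
    linarith
  calc _ ≤ ∫⁻ q, ENNReal.ofReal (∑ j, N⁻¹ * (F (q.1 j) q.2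
        + N⁻¹ * ∑ i, u (q.1 j) q.2 * r (q.1 i) q.2 + 1 - 2 * r (q.1 j) q.2)) ∂m :=
        lintegral_mono fun q => ENNReal.ofReal_le_ofReal
          (klFun_average_le (fun j => h.nonneg _ _) (h.pos _))
    _ = ENNReal.ofReal (∫ q, ∑ j, N⁻¹ * (F (q.1 j) q.2
        + N⁻¹ * ∑ i, u (q.1 j) q.2 * r (q.1 i) q.2 + 1 - 2 * r (q.1 j) q.2) ∂m) := by
        rw [ofReal_integral_eq_lintegral_ofReal (integrable_finsetSum _ fun j _ => (hterm j).1)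
          (ae_of_all _ fun q => ?_)]
        exact (InformationTheory.klFun_nonneg (mul_nonneg (by positivity)
          (Finset.sum_nonneg fun j _ => h.nonneg _ _))).trans
          (klFun_average_le (fun j => h.nonneg _ _) (h.pos _))
    _ ≤ _ := by
        refine ENNReal.ofReal_le_ofReal ?_
        rw [integral_finsetSum _ fun j _ => (hterm j).1]
        calc _ ≤ ∑ _j : J, N⁻¹ * ∫ q, F q.1 q.2 ∂(μ.prod ν) :=
              Finset.sum_le_sum fun j _ => (hterm j).2
          _ = _ := by
              rw [Finset.sum_const, Finset.card_univ, nsmul_eq_mul, ← hNdef,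
                mul_inv_cancel_left₀ hN.ne']

end IsChannelDensity

end RandomCoding

/-! ### Threshold decoding and the selection of a codebook -/

section ThresholdDecoder

variable {X Y : Type*} [MeasurableSpace X] [MeasurableSpace Y]

/-- A rule that decides for an element of a candidate set whenever the set is nonempty. -/
noncomputable def pickCandidate {M : ℕ} (hM : 0 < M) (S : Fin M → Prop) : Fin M :=
  open Classical in if h : ∃ m, S m then h.choose else ⟨0, hM⟩

theorem pickCandidate_spec {M : ℕ} (hM : 0 < M) {S : Fin M → Prop} (h : ∃ m, S m) :
    S (pickCandidate hM S) := by
  rw [pickCandidate, dif_pos h]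
  exact h.choose_spec

/-- The arbitrary choice is harmless for measurability: it depends on `y` only through the candidate
set, which ranges over the finite type `Fin M → Prop`. -/
theorem measurableSet_pickCandidate {M : ℕ} (hM : 0 < M) {S : Fin M → Y → Prop}
    (hS : ∀ m, MeasurableSet {y | S m y}) (m : Fin M) :
    MeasurableSet {y | pickCandidate hM (fun m' => S m' y) = m} := by
  have h1 : Measurable fun y => fun m' => S m' y :=
    measurable_pi_lambda _ fun m' => measurableSet_setOfPred.1 (hS m')
  have h2 : Measurable (pickCandidate hM) := measurable_of_finite _
  exact (h2.comp h1) (MeasurableSet.singleton m)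

namespace IsChannelDensity

variable {μ : Measure X} {ν : Measure Y} [IsProbabilityMeasure μ] [IsProbabilityMeasure ν]
  {r : X → Y → ℝ} {w : Y → ℝ}

/-- The union bound on the error of threshold decoding for the message `j.1` and the key `j.2`. -/
noncomputable def thresholdError (r : X → Y → ℝ) (w : Y → ℝ) (t : ℝ) {M K : ℕ}
    (j : Fin M × Fin K) (q : (Fin M × Fin K → X) × Y) : ℝ≥0∞ :=
  ENNReal.ofReal (r (q.1 j) q.2) *
      {q : X × Y | r q.1 q.2 ≤ t * w q.2}.indicator 1 (q.1 j, q.2)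
    + ∑ m' ∈ Finset.univ.erase j.1, {q : X × Y | t * w q.2 < r q.1 q.2}.indicator 1
        (q.1 (m', j.2), q.2) * ENNReal.ofReal (r (q.1 j) q.2)

theorem measurableSet_le_mul {μ : Measure X} {ν : Measure Y}
    (h : IsChannelDensity μ ν r w) (t : ℝ) :
    MeasurableSet {q : X × Y | r q.1 q.2 ≤ t * w q.2} :=
  measurableSet_le h.measurable_r ((h.measurable_w.comp measurable_snd).const_mul t)

theorem measurableSet_mul_lt {μ : Measure X} {ν : Measure Y}
    (h : IsChannelDensity μ ν r w) (t : ℝ) :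
    MeasurableSet {q : X × Y | t * w q.2 < r q.1 q.2} :=
  measurableSet_lt ((h.measurable_w.comp measurable_snd).const_mul t) h.measurable_r

theorem measurable_thresholdError (h : IsChannelDensity μ ν r w) (t : ℝ) {M K : ℕ}
    (j : Fin M × Fin K) : Measurable (thresholdError r w t j) := by
  have hev := fun i : Fin M × Fin K => (measurePreserving_codebook_single μ ν i).measurable
  have hr : Measurable fun q : (Fin M × Fin K → X) × Y => ENNReal.ofReal (r (q.1 j) q.2) :=
    (h.measurable_r.comp (hev j)).ennreal_ofReal
  have h1 : Measurable fun q : (Fin M × Fin K → X) × Y =>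
      {q : X × Y | r q.1 q.2 ≤ t * w q.2}.indicator (1 : X × Y → ℝ≥0∞) (q.1 j, q.2) :=
    (measurable_one.indicator (h.measurableSet_le_mul t)).comp (hev j)
  have h2 : ∀ m' : Fin M, Measurable fun q : (Fin M × Fin K → X) × Y =>
      {q : X × Y | t * w q.2 < r q.1 q.2}.indicator (1 : X × Y → ℝ≥0∞) (q.1 (m', j.2), q.2) :=
    fun m' => (measurable_one.indicator (h.measurableSet_mul_lt t)).comp (hev _)
  exact (hr.mul h1).add (Finset.measurable_fun_sum _ fun m' _ => (h2 m').mul hr)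

/-- The first term is the chance that the sent codeword misses the threshold. A wrong codeword under
the same key is independent of the output, hence passes with probability at most `1 / t`, because `w
< r / t` where it passes; there are fewer than `M` of them. -/
theorem lintegral_thresholdError_le (h : IsChannelDensity μ ν r w) {t : ℝ} (ht : 0 < t) {M K : ℕ}
    (j : Fin M × Fin K) :
    ∫⁻ q, thresholdError r w t j q ∂((Measure.pi fun _ : Fin M × Fin K => μ).prod ν)
      ≤ ∫⁻ q in {q : X × Y | r q.1 q.2 ≤ t * w q.2}, ENNReal.ofReal (r q.1 q.2) ∂(μ.prod ν)
        + ENNReal.ofReal (M / t) := by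
  have hev := fun i : Fin M × Fin K => (measurePreserving_codebook_single μ ν i).measurable
  have hr : Measurable fun q : (Fin M × Fin K → X) × Y => ENNReal.ofReal (r (q.1 j) q.2) :=
    (h.measurable_r.comp (hev j)).ennreal_ofReal
  have h2 : ∀ m' : Fin M, Measurable fun q : (Fin M × Fin K → X) × Y =>
      {q : X × Y | t * w q.2 < r q.1 q.2}.indicator (1 : X × Y → ℝ≥0∞) (q.1 (m', j.2), q.2) :=
    fun m' => (measurable_one.indicator (h.measurableSet_mul_lt t)).comp (hev _)
  have hI1 : Measurable ({q : X × Y | r q.1 q.2 ≤ t * w q.2}.indicator (1 : X × Y → ℝ≥0∞)) :=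
    measurable_one.indicator (h.measurableSet_le_mul t)
  have hI2 : Measurable ({q : X × Y | t * w q.2 < r q.1 q.2}.indicator (1 : X × Y → ℝ≥0∞)) :=
    measurable_one.indicator (h.measurableSet_mul_lt t)
  have h3 : ∀ m' : Fin M, Measurable fun q : (Fin M × Fin K → X) × Y =>
      {q : X × Y | t * w q.2 < r q.1 q.2}.indicator (1 : X × Y → ℝ≥0∞) (q.1 (m', j.2), q.2)
        * ENNReal.ofReal (r (q.1 j) q.2) := fun m' => (h2 m').mul hr
  have hsm : Measurable fun q : (Fin M × Fin K → X) × Y => ∑ m' ∈ Finset.univ.erase j.1,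
      {q : X × Y | t * w q.2 < r q.1 q.2}.indicator (1 : X × Y → ℝ≥0∞)
        (q.1 (m', j.2), q.2) * ENNReal.ofReal (r (q.1 j) q.2) :=
    Finset.measurable_fun_sum _ fun m' _ => h3 m'
  unfold thresholdError
  rw [lintegral_add_right _ hsm]
  refine add_le_add (le_of_eq ?_) ?_
  · rw [lintegral_codebook_single (u := fun x y => ENNReal.ofReal (r x y) *
      {q : X × Y | r q.1 q.2 ≤ t * w q.2}.indicator 1 (x, y))
      (h.measurable_r.ennreal_ofReal.mul hI1),
      ← lintegral_indicator (h.measurableSet_le_mul t)]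
    refine lintegral_congr fun q => ?_
    by_cases hq : q ∈ {q : X × Y | r q.1 q.2 ≤ t * w q.2}
    · rw [Set.indicator_of_mem hq, Set.indicator_of_mem hq, Pi.one_apply, mul_one]
    · rw [Set.indicator_of_notMem hq, Set.indicator_of_notMem hq, mul_zero]
  · rw [lintegral_finsetSum _ fun m' _ => h3 m']
    have hone : ∀ m' ∈ Finset.univ.erase j.1, ∫⁻ q : (Fin M × Fin K → X) × Y,
        {q : X × Y | t * w q.2 < r q.1 q.2}.indicator (1 : X × Y → ℝ≥0∞) (q.1 (m', j.2), q.2)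
          * ENNReal.ofReal (r (q.1 j) q.2) ∂((Measure.pi fun _ : Fin M × Fin K => μ).prod ν)
        ≤ ENNReal.ofReal (1 / t) := by
      intro m' hm'
      have hne : (m', j.2) ≠ j := fun he => (Finset.ne_of_mem_erase hm') (congrArg Prod.fst he)
      rw [h.lintegral_codebook_pair hne (u := fun x y =>
        {q : X × Y | t * w q.2 < r q.1 q.2}.indicator 1 (x, y)) hI2]
      calc _ ≤ ∫⁻ q, ENNReal.ofReal (1 / t) * ENNReal.ofReal (r q.1 q.2) ∂(μ.prod ν) := by
            refine lintegral_mono fun q => ?_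
            by_cases hq : q ∈ {q : X × Y | t * w q.2 < r q.1 q.2}
            · rw [Set.indicator_of_mem hq, Pi.one_apply, one_mul,
                ← ENNReal.ofReal_mul (by positivity)]
              refine ENNReal.ofReal_le_ofReal ?_
              rw [one_div, ← div_eq_inv_mul, le_div_iff₀ ht, mul_comm]
              exact le_of_lt hq
            · rw [Set.indicator_of_notMem hq, zero_mul]
              exact zero_le
        _ = _ := by
            rw [lintegral_const_mul _ h.measurable_r.ennreal_ofReal, h.lintegral_prod_eq_one,
              mul_one]
    calc _ ≤ ∑ m' ∈ Finset.univ.erase j.1, ENNReal.ofReal (1 / t) := Finset.sum_le_sum hone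
      _ ≤ ∑ _m' : Fin M, ENNReal.ofReal (1 / t) :=
          Finset.sum_le_sum_of_subset (Finset.erase_subset _ _)
      _ = _ := by
          rw [Finset.sum_const, Finset.card_univ, Fintype.card_fin, nsmul_eq_mul,
            ← ENNReal.ofReal_natCast, ← ENNReal.ofReal_mul (by positivity)]
          congr 1
          ring

/-- Random coding: a codebook and a decoder that are simultaneously good for the divergence of the
output law and for the probability of decoding error. -/
theorem exists_codebook (h : IsChannelDensity μ ν r w) {good : X → Prop} (hgood : ∀ᵐ x ∂μ, good x)
    {M : ℕ} (hM : 0 < M) {t : ℝ} (ht : 0 < t) {D : ℝ}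
    (hD : ∫ q, r q.1 q.2 * Real.log (w q.2) ∂(μ.prod ν) < D) (a b : ℝ≥0∞) :
    ∃ K : ℕ, 0 < K ∧ ∃ c : Fin M × Fin K → X, (∀ j, good (c j)) ∧
      ∃ dec : Y → Fin K → Fin M, (∀ k m, MeasurableSet {y | dec y k = m}) ∧
      a * ∫⁻ y, ENNReal.ofReal (InformationTheory.klFun
          (((Fintype.card (Fin M × Fin K) : ℕ) : ℝ)⁻¹ * ∑ j, r (c j) y)) ∂ν
        + b * (((Fintype.card (Fin M × Fin K) : ℕ) : ℝ≥0∞)⁻¹ *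
          ∑ j : Fin M × Fin K, ∫⁻ y in {y | dec y j.2 ≠ j.1}, ENNReal.ofReal (r (c j) y) ∂ν)
      ≤ a * ENNReal.ofReal D + b *
        (∫⁻ q in {q : X × Y | r q.1 q.2 ≤ t * w q.2}, ENNReal.ofReal (r q.1 q.2) ∂(μ.prod ν)
          + ENNReal.ofReal (M / t)) := by
  obtain ⟨N₀, hN₀⟩ := eventually_atTop.1 (h.tendsto_integral_mul_log_add.eventually_lt_const hD)
  -- Keys are free, so their number is raised until the codebook is large enough for the divergence
  -- bound.
  set K := N₀ + 1 with hK
  have hK0 : 0 < K := Nat.succ_pos _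
  have : Nonempty (Fin M × Fin K) := ⟨(⟨0, hM⟩, ⟨0, hK0⟩)⟩
  set N := Fintype.card (Fin M × Fin K) with hN
  have hNN : N₀ ≤ N := by
    have : N = M * K := by simp [hN]
    rw [this]
    nlinarith
  have hNpos : 0 < N := Fintype.card_pos
  set P := Measure.pi fun _ : Fin M × Fin K => μ with hP
  set F : (Fin M × Fin K → X) × Y → ℝ≥0∞ := fun q =>
    ENNReal.ofReal (InformationTheory.klFun ((N : ℝ)⁻¹ * ∑ j, r (q.1 j) q.2)) with hF
  have hFm : Measurable F := by
    refine (InformationTheory.measurable_klFun.comp (Measurable.const_mul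
      (Finset.measurable_fun_sum _ fun j _ => ?_) _)).ennreal_ofReal
    exact h.measurable_r.comp (measurePreserving_codebook_single μ ν j).measurable
  have hEm := fun j : Fin M × Fin K => h.measurable_thresholdError t j
  set G : (Fin M × Fin K → X) → ℝ≥0∞ := fun c => a * ∫⁻ y, F (c, y) ∂ν
    + b * ((N : ℝ≥0∞)⁻¹ * ∑ j, ∫⁻ y, thresholdError r w t j (c, y) ∂ν) with hG
  have hm1 : Measurable fun c => a * ∫⁻ y, F (c, y) ∂ν := hFm.lintegral_prod_right'.const_mul _
  have hm2 : Measurable fun c => ∑ j, ∫⁻ y, thresholdError r w t j (c, y) ∂ν :=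
    Finset.measurable_fun_sum _ fun j _ => (hEm j).lintegral_prod_right'
  have hGm : Measurable G := hm1.add ((hm2.const_mul _).const_mul _)
  have hGint : ∫⁻ c, G c ∂P ≤ a * ENNReal.ofReal D + b *
        (∫⁻ q in {q : X × Y | r q.1 q.2 ≤ t * w q.2}, ENNReal.ofReal (r q.1 q.2) ∂(μ.prod ν)
          + ENNReal.ofReal (M / t)) := by
    rw [hG, lintegral_add_left hm1, lintegral_const_mul _ hFm.lintegral_prod_right',
      lintegral_const_mul _ (hm2.const_mul _), lintegral_const_mul _ hm2,
      lintegral_finsetSum _ fun j _ => (hEm j).lintegral_prod_right',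
      ← lintegral_prod _ hFm.aemeasurable]
    simp_rw [← lintegral_prod _ (hEm _).aemeasurable]
    gcongr
    · refine h.lintegral_klFun_codebook_le.trans (ENNReal.ofReal_le_ofReal (hN₀ N hNN).le)
    · calc _ ≤ (N : ℝ≥0∞)⁻¹ * ∑ _j : Fin M × Fin K, (∫⁻ q in {q : X × Y | r q.1 q.2 ≤ t * w q.2},
              ENNReal.ofReal (r q.1 q.2) ∂(μ.prod ν) + ENNReal.ofReal (M / t)) := by
            gcongr with j
            exact h.lintegral_thresholdError_le ht j
        _ = _ := by
            rw [Finset.sum_const, Finset.card_univ, nsmul_eq_mul, ← mul_assoc, ← hN,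
              ENNReal.inv_mul_cancel (by exact_mod_cast hNpos.ne') (by simp), one_mul]
  have hgood' : ∀ᵐ c ∂P, ∀ j, good (c j) := by
    rw [ae_all_iff]
    exact fun j => (measurePreserving_eval (fun _ : Fin M × Fin K => μ) j).quasiMeasurePreserving.ae
      hgood
  -- Averaging one weighted sum of divergence and error, instead of each separately, yields a single
  -- codebook that serves both, and it can avoid the null set where some codeword is not good.
  obtain ⟨c, hc, hcG⟩ := exists_notMem_null_le_lintegral hGm.aemeasurable (ae_iff.1 hgood')
  simp only [Set.mem_ofPred_eq, not_not] at hc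
  have hmeas : ∀ m k, MeasurableSet {y | t * w y < r (c (m, k)) y} := fun m k =>
    (h.measurableSet_mul_lt t).preimage (measurable_const (a := c (m, k)) |>.prodMk measurable_id)
  refine ⟨K, hK0, c, hc, fun y k => pickCandidate hM fun m => t * w y < r (c (m, k)) y,
    fun k m => measurableSet_pickCandidate hM (fun m' => hmeas m' k) m,
    le_trans ?_ (hcG.trans hGint)⟩
  refine add_le_add le_rfl (mul_le_mul' le_rfl (mul_le_mul' le_rfl
    (Finset.sum_le_sum fun j _ => ?_)))
  have hset : MeasurableSet {y | pickCandidate hM (fun m => t * w y < r (c (m, j.2)) y) ≠ j.1} :=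
    (measurableSet_pickCandidate hM (fun m' => hmeas m' j.2) j.1).compl
  rw [← lintegral_indicator hset]
  refine lintegral_mono fun y => ?_
  rw [Set.indicator_apply]
  split_ifs with hy
  · simp only [thresholdError]
    -- On a wrong decision, either the true codeword failed the threshold or the candidate set was
    -- nonempty and the picked wrong candidate passed it.
    by_cases hj : r (c j) y ≤ t * w y
    · refine le_add_right (le_of_eq ?_)
      rw [Set.indicator_of_mem (by exact hj), Pi.one_apply, mul_one]
    · refine le_add_left ?_
      have hex : ∃ m, t * w y < r (c (m, j.2)) y := ⟨j.1, not_le.1 hj⟩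
      have hsp := pickCandidate_spec hM hex
      refine le_trans ?_ (Finset.single_le_sum (fun _ _ => zero_le)
        (Finset.mem_erase.2 ⟨hy, Finset.mem_univ _⟩))
      rw [Set.indicator_of_mem (by exact hsp), Pi.one_apply, one_mul]
  · exact zero_le

end IsChannelDensity

end ThresholdDecoder

/-! ### Surprisal, exponential tilting and shifted noise -/

section Density

/-- A measurable bounded probability density with an integrable power of exponent `ζ < 1`. -/
structure RegularDensity (p : ℝ → ℝ) (b ζ : ℝ) : Prop where
  measurable : Measurable p
  nonneg : ∀ z, 0 ≤ p z
  one_le : 1 ≤ b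
  le_bound : ∀ z, p z ≤ b
  integrable : Integrable p volume
  integral_eq_one : ∫ z, p z = 1
  exponent_mem : ζ ∈ Set.Ioo (0 : ℝ) 1
  integrable_rpow : Integrable (fun z => p z ^ ζ) volume

/-- The information content `-ln p` of a density. -/
noncomputable def surprisal (p : ℝ → ℝ) (z : ℝ) : ℝ := -Real.log (p z)

/-- The information content of a vector with i.i.d. coordinates of density `p`. -/
noncomputable def totalSurprisal (p : ℝ → ℝ) {n : ℕ} (y : Fin n → ℝ) : ℝ :=
  ∑ i, surprisal p (y i)

/-- The density of the noise vector shifted by `x`, relative to the unshifted one. -/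
noncomputable def shiftDensity (p : ℝ → ℝ) {n : ℕ} (x y : Fin n → ℝ) : ℝ :=
  (∏ i, p (y i - x i)) / ∏ i, p (y i)

namespace RegularDensity

variable {p : ℝ → ℝ} {b ζ : ℝ}

theorem measurable_surprisal (h : RegularDensity p b ζ) : Measurable (surprisal p) :=
  h.measurable.log.neg

theorem measurable_totalSurprisal (h : RegularDensity p b ζ) (n : ℕ) :
    Measurable fun y : Fin n → ℝ => totalSurprisal p y :=
  Finset.measurable_fun_sum _ fun i _ => h.measurable_surprisal.comp (measurable_pi_apply i)

theorem neg_log_le_surprisal (h : RegularDensity p b ζ) (z : ℝ) : -Real.log b ≤ surprisal p z := by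
  rw [surprisal, neg_le_neg_iff]
  -- At a zero of `p` the default value `log 0 = 0` gives surprisal `0`; this case needs `1 ≤ b`.
  rcases (h.nonneg z).eq_or_lt with h0 | h0
  · rw [← h0, Real.log_zero]
    exact Real.log_nonneg h.one_le
  · exact Real.log_le_log h0 (h.le_bound z)

theorem isProbabilityMeasure (h : RegularDensity p b ζ) : IsProbabilityMeasure (lawOf p) := by
  constructor
  rw [lawOf, withDensity_apply _ MeasurableSet.univ, Measure.restrict_univ,
    ← ofReal_integral_eq_lintegral_ofReal h.integrable (ae_of_all _ h.nonneg), h.integral_eq_one]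
  simp

theorem isProbabilityMeasure_noiseLaw (h : RegularDensity p b ζ) (n : ℕ) :
    IsProbabilityMeasure (noiseLaw p n) := by
  have := h.isProbabilityMeasure
  unfold noiseLaw
  infer_instance

theorem ae_pos (h : RegularDensity p b ζ) : ∀ᵐ z ∂(lawOf p), 0 < p z := by
  rw [lawOf, ae_withDensity_iff h.measurable.ennreal_ofReal]
  refine ae_of_all _ fun z hz => ?_
  simpa using hz

theorem ae_pos_noiseLaw (h : RegularDensity p b ζ) (n : ℕ) :
    ∀ᵐ z ∂(noiseLaw p n), ∀ i, 0 < p (z i) := by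
  have := h.isProbabilityMeasure
  rw [ae_all_iff]
  exact fun i => (measurePreserving_eval (fun _ : Fin n => lawOf p) i).quasiMeasurePreserving.ae
    h.ae_pos

/-- This links powers of the density with exponential moments of the surprisal. It survives at zeros
of `p`, where both sides vanish because `1 - γ ≠ 0`. -/
theorem mul_exp_surprisal (h : RegularDensity p b ζ) {γ : ℝ} (hγ : γ < 1) (z : ℝ) :
    p z * Real.exp (γ * surprisal p z) = p z ^ (1 - γ) := by
  rcases (h.nonneg z).eq_or_lt with h0 | h0
  · rw [← h0, zero_mul, Real.zero_rpow (by linarith)]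
  · rw [Real.rpow_sub h0, Real.rpow_one, Real.rpow_def_of_pos h0, surprisal, div_eq_mul_inv,
      ← Real.exp_neg]
    ring_nf

/-- At `t = 1 - ζ` this is the integrability of `p ^ ζ`. Smaller `t`, negative ones included, follow
because the surprisal is bounded below. -/
theorem integrable_exp_surprisal (h : RegularDensity p b ζ) {t : ℝ} (ht : t ≤ 1 - ζ) :
    Integrable (fun z => Real.exp (t * surprisal p z)) (lawOf p) := by
  have hζ := h.exponent_mem
  have h1 : Integrable (fun z => Real.exp ((1 - ζ) * surprisal p z)) (lawOf p) := by
    rw [lawOf, integrable_withDensity_ofReal_iff h.measurable h.nonneg]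
    simp_rw [h.mul_exp_surprisal (show 1 - ζ < 1 by linarith [hζ.1])]
    simpa using h.integrable_rpow
  refine (h1.const_mul (Real.exp ((1 - ζ - t) * Real.log b))).mono'
    (h.measurable_surprisal.const_mul t).exp.aestronglyMeasurable (ae_of_all _ fun z => ?_)
  rw [Real.norm_of_nonneg (Real.exp_pos _).le, ← Real.exp_add, Real.exp_le_exp]
  have := mul_le_mul_of_nonneg_left (h.neg_log_le_surprisal z) (sub_nonneg.2 ht)
  linarith

theorem mem_interior_integrableExpSet (h : RegularDensity p b ζ) {t : ℝ} (ht : t < 1 - ζ) :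
    t ∈ interior (integrableExpSet (surprisal p) (lawOf p)) := by
  rw [mem_interior]
  exact ⟨Set.Iio (1 - ζ), fun s hs => h.integrable_exp_surprisal (le_of_lt hs), isOpen_Iio, ht⟩

theorem zero_mem_interior (h : RegularDensity p b ζ) :
    0 ∈ interior (integrableExpSet (surprisal p) (lawOf p)) :=
  h.mem_interior_integrableExpSet (by linarith [h.exponent_mem.2])

theorem integral_exp_surprisal (h : RegularDensity p b ζ) {t : ℝ} (ht : t ≤ 1 - ζ) :
    ∫ z, Real.exp (t * surprisal p z) ∂(lawOf p) = Real.exp (cgf (surprisal p) (lawOf p) t) := by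
  have := h.isProbabilityMeasure
  rw [exp_cgf (h.integrable_exp_surprisal ht)]
  rfl

theorem tilted_surprisal_eq (h : RegularDensity p b ζ) {γ : ℝ} (hγ : γ ≤ 1 - ζ) :
    (lawOf p).tilted (γ * surprisal p ·) = (lawOf p).withDensity fun z =>
      ENNReal.ofReal (Real.exp (γ * surprisal p z - cgf (surprisal p) (lawOf p) γ)) := by
  rw [Measure.tilted, h.integral_exp_surprisal hγ]
  simp_rw [← Real.exp_sub]

/-- Brings the decomposability assumption into exponential-family form, where means and variances
are derivatives of the cumulant generating function. -/
theorem lawOf_tilted (h : RegularDensity p b ζ) {γ : ℝ} (hγ : γ ≤ 1 - ζ) :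
    lawOf (tilted p γ) = (lawOf p).tilted (γ * surprisal p ·) := by
  have hγ1 : γ < 1 := by linarith [h.exponent_mem.1]
  have hI : ∫ t, p t ^ (1 - γ) = Real.exp (cgf (surprisal p) (lawOf p) γ) := by
    rw [← h.integral_exp_surprisal hγ, lawOf, integral_withDensity_ofReal h.measurable h.nonneg]
    simp_rw [h.mul_exp_surprisal hγ1]
  have hm : Measurable fun z => Real.exp (γ * surprisal p z - cgf (surprisal p) (lawOf p) γ) :=
    ((h.measurable_surprisal.const_mul γ).sub_const _).exp
  rw [h.tilted_surprisal_eq hγ]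
  generalize cgf (surprisal p) (lawOf p) γ = c at hI hm ⊢
  conv_rhs => rw [lawOf]
  rw [← withDensity_mul _ h.measurable.ennreal_ofReal hm.ennreal_ofReal, lawOf]
  congr 1
  funext z
  rw [Pi.mul_apply, ← ENNReal.ofReal_mul (h.nonneg z), tilted, hI, ← h.mul_exp_surprisal hγ1,
    Real.exp_sub]
  congr 1
  ring

theorem integrable_exp_totalSurprisal (h : RegularDensity p b ζ) {t : ℝ} (ht : t ≤ 1 - ζ) (n : ℕ) :
    Integrable (fun y => Real.exp (t * totalSurprisal p y)) (noiseLaw p n) := by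
  have := h.isProbabilityMeasure
  simp_rw [totalSurprisal, Finset.mul_sum, Real.exp_sum]
  exact Integrable.fintype_prod fun _ => h.integrable_exp_surprisal ht

theorem integral_exp_totalSurprisal (h : RegularDensity p b ζ) {t : ℝ} (ht : t ≤ 1 - ζ) (n : ℕ) :
    ∫ y, Real.exp (t * totalSurprisal p y) ∂(noiseLaw p n)
      = Real.exp (n * cgf (surprisal p) (lawOf p) t) := by
  have := h.isProbabilityMeasure
  simp_rw [totalSurprisal, Finset.mul_sum, Real.exp_sum]
  rw [noiseLaw, integral_fintype_prod_eq_pow (fun z => Real.exp (t * surprisal p z)),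
    h.integral_exp_surprisal ht, Fintype.card_fin, ← Real.exp_nat_mul]

theorem pi_tilted_eq (h : RegularDensity p b ζ) {γ : ℝ} (hγ : γ ≤ 1 - ζ) (n : ℕ) :
    Measure.pi (fun _ : Fin n => (lawOf p).tilted (γ * surprisal p ·))
      = (noiseLaw p n).withDensity fun y => ENNReal.ofReal
        (Real.exp (γ * totalSurprisal p y - n * cgf (surprisal p) (lawOf p) γ)) := by
  have := h.isProbabilityMeasure
  have hi : Integrable (fun z => Real.exp (γ * surprisal p z - cgf (surprisal p) (lawOf p) γ))
      (lawOf p) := by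
    simp_rw [Real.exp_sub]
    exact (h.integrable_exp_surprisal hγ).div_const _
  rw [h.tilted_surprisal_eq hγ, pi_withDensity_ofReal (fun _ : Fin n => lawOf p) (fun _ => hi)
    fun _ _ => (Real.exp_pos _).le, noiseLaw]
  simp_rw [← Real.exp_sum, Finset.sum_sub_distrib, totalSurprisal, Finset.mul_sum]
  simp

theorem isProbabilityMeasure_tilted (h : RegularDensity p b ζ) {γ : ℝ} (hγ : γ ≤ 1 - ζ) :
    IsProbabilityMeasure ((lawOf p).tilted (γ * surprisal p ·)) := by
  have := h.isProbabilityMeasure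
  exact MeasureTheory.isProbabilityMeasure_tilted (h.integrable_exp_surprisal hγ)

theorem noiseLaw_eq (h : RegularDensity p b ζ) (n : ℕ) :
    noiseLaw p n = volume.withDensity fun y => ENNReal.ofReal (∏ i, p (y i)) := by
  rw [noiseLaw, volume_pi]
  exact pi_withDensity_ofReal (fun _ : Fin n => (volume : Measure ℝ)) (fun _ => h.integrable)
    fun _ => h.nonneg

theorem measurable_prod (h : RegularDensity p b ζ) (n : ℕ) :
    Measurable fun y : Fin n → ℝ => ∏ i, p (y i) :=
  Finset.measurable_fun_prod _ fun i _ => h.measurable.comp (measurable_pi_apply i)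

theorem measurable_shiftDensity (h : RegularDensity p b ζ) (n : ℕ) :
    Measurable fun q : (Fin n → ℝ) × (Fin n → ℝ) => shiftDensity p q.1 q.2 := by
  refine Measurable.div ?_ ((h.measurable_prod n).comp measurable_snd)
  exact (h.measurable_prod n).comp (measurable_snd.sub measurable_fst)

theorem shiftDensity_nonneg (h : RegularDensity p b ζ) {n : ℕ} (x y : Fin n → ℝ) :
    0 ≤ shiftDensity p x y :=
  div_nonneg (Finset.prod_nonneg fun _ _ => h.nonneg _) (Finset.prod_nonneg fun _ _ => h.nonneg _)

theorem map_add_left_eq (h : RegularDensity p b ζ) {n : ℕ} (x : Fin n → ℝ) :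
    (noiseLaw p n).map (fun z => x + z)
      = volume.withDensity fun y => ENNReal.ofReal (∏ i, p (y i - x i)) := by
  have hm : Measurable fun z : Fin n → ℝ => x + z := measurable_const.add measurable_id
  ext s hs
  rw [Measure.map_apply hm hs, h.noiseLaw_eq, withDensity_apply _ (hm hs),
    withDensity_apply _ hs, ← lintegral_indicator hs, ← lintegral_indicator (hm hs),
    
    ← lintegral_add_left_eq_self (s.indicator fun y => ENNReal.ofReal (∏ i, p (y i - x i))) x]
  refine lintegral_congr fun z => ?_
  by_cases hz : x + z ∈ s
  · rw [Set.indicator_of_mem hz, Set.indicator_of_mem (by exact hz)]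
    simp
  · rw [Set.indicator_of_notMem hz, Set.indicator_of_notMem (by exact hz)]

/-- A shifted noise law that does not charge the zeros of the density has a density with respect
to the noise law. -/
theorem map_add_left_eq_withDensity (h : RegularDensity p b ζ) {n : ℕ} {x : Fin n → ℝ}
    (hx : ∀ᵐ z ∂(noiseLaw p n), ∀ i, 0 < p (x i + z i)) :
    (noiseLaw p n).map (fun z => x + z)
      = (noiseLaw p n).withDensity fun y => ENNReal.ofReal (shiftDensity p x y) := by
  have hm : Measurable fun z : Fin n → ℝ => x + z := measurable_const.add measurable_id
  have hset : MeasurableSet {y : Fin n → ℝ | ∀ i, 0 < p (y i)} := by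
    have : {y : Fin n → ℝ | ∀ i, 0 < p (y i)} = ⋂ i, {y | 0 < p (y i)} := by ext; simp
    rw [this]
    exact MeasurableSet.iInter fun i =>
      measurableSet_lt measurable_const (h.measurable.comp (measurable_pi_apply i))
  have hx' : ∀ᵐ y ∂((noiseLaw p n).map fun z => x + z), ∀ i, 0 < p (y i) := by
    rw [ae_map_iff hm.aemeasurable hset]
    exact hx
  have hsd : Measurable fun y : Fin n → ℝ => shiftDensity p x y :=
    (h.measurable_shiftDensity n).comp (measurable_const.prodMk measurable_id)
  have hnum : Measurable fun y : Fin n → ℝ => ∏ i, p (y i - x i) :=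
    (h.measurable_prod n).comp (measurable_id.sub measurable_const)
  rw [h.map_add_left_eq, ae_withDensity_iff hnum.ennreal_ofReal] at hx'
  rw [h.map_add_left_eq, h.noiseLaw_eq,
    ← withDensity_mul _ (h.measurable_prod n).ennreal_ofReal hsd.ennreal_ofReal]
  refine withDensity_congr_ae ?_
  filter_upwards [hx'] with y hy
  rw [Pi.mul_apply, ← ENNReal.ofReal_mul (Finset.prod_nonneg fun _ _ => h.nonneg _), shiftDensity]
  -- The quotient takes the default value `0` where its denominator vanishes. That is correct almost
  -- everywhere: the hypothesis excludes a positive numerator over a zero denominator.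
  by_cases h0 : ∏ i, p (y i - x i) = 0
  · simp [h0]
  · have hpos : 0 < ∏ i, p (y i - x i) :=
      lt_of_le_of_ne (Finset.prod_nonneg fun _ _ => h.nonneg _) (Ne.symm h0)
    have := hy (by simpa using hpos)
    rw [mul_div_cancel₀ _ (Finset.prod_pos fun i _ => this i).ne']

theorem log_shiftDensity {n : ℕ} {x z : Fin n → ℝ} (hz : ∀ i, 0 < p (z i))
    (hx : ∀ i, 0 < p (x i + z i)) :
    Real.log (shiftDensity p x (x + z)) = totalSurprisal p (x + z) - totalSurprisal p z := by
  simp only [shiftDensity, Pi.add_apply, add_sub_cancel_left]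
  rw [Real.log_div (Finset.prod_pos fun i _ => hz i).ne' (Finset.prod_pos fun i _ => hx i).ne',
    Real.log_prod fun i _ => (hz i).ne', Real.log_prod fun i _ => (hx i).ne']
  simp only [totalSurprisal, surprisal, Finset.sum_neg_distrib, Pi.add_apply]
  ring

theorem neg_mul_log_le_totalSurprisal (h : RegularDensity p b ζ) {n : ℕ} (y : Fin n → ℝ) :
    -(n * Real.log b) ≤ totalSurprisal p y := by
  calc -(n * Real.log b) = ∑ _i : Fin n, -Real.log b := by simp
    _ ≤ _ := Finset.sum_le_sum fun i _ => h.neg_log_le_surprisal _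

theorem integrable_surprisal (h : RegularDensity p b ζ) : Integrable (surprisal p) (lawOf p) :=
  integrable_of_mem_interior_integrableExpSet h.zero_mem_interior

theorem integrable_totalSurprisal (h : RegularDensity p b ζ) (n : ℕ) :
    Integrable (fun y => totalSurprisal p y) (noiseLaw p n) := by
  have := h.isProbabilityMeasure
  exact integrable_finsetSum _ fun i _ =>
    (measurePreserving_eval (fun _ : Fin n => lawOf p) i).integrable_comp_of_integrable
      h.integrable_surprisal

theorem integral_totalSurprisal (h : RegularDensity p b ζ) (n : ℕ) :
    ∫ y, totalSurprisal p y ∂(noiseLaw p n) = n * ∫ z, surprisal p z ∂(lawOf p) := by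
  have := h.isProbabilityMeasure
  have hmp := fun i : Fin n => measurePreserving_eval (fun _ : Fin n => lawOf p) i
  simp only [totalSurprisal, noiseLaw]
  rw [integral_finsetSum (f := fun i (y : Fin n → ℝ) => surprisal p (y i)) _ fun i _ =>
    (hmp i).integrable_comp_of_integrable h.integrable_surprisal]
  have : ∀ i : Fin n, ∫ y, surprisal p (y i) ∂(Measure.pi fun _ : Fin n => lawOf p)
      = ∫ z, surprisal p z ∂(lawOf p) := by
    exact fun i => integral_comp_measurePreserving (hmp i)
      h.measurable_surprisal.aestronglyMeasurable
  simp [this]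

end RegularDensity

end Density

/-! ### Converse: a length bound for covert and reliable codes -/

section Converse

variable {p : ℝ → ℝ} {b ζ : ℝ}

theorem measurable_const_add_pi {n : ℕ} (x : Fin n → ℝ) : Measurable fun z : Fin n → ℝ => x + z :=
  measurable_const.add measurable_id

theorem RegularDensity.isProbabilityMeasure_map (h : RegularDensity p b ζ) {n : ℕ}
    (x : Fin n → ℝ) : IsProbabilityMeasure ((noiseLaw p n).map fun z => x + z) := by
  have := h.isProbabilityMeasure_noiseLaw n
  exact Measure.isProbabilityMeasure_map (measurable_const_add_pi x).aemeasurable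

/-- A bound on the probability that a shifted noise vector falls into a decision region. -/
theorem RegularDensity.log_mul_measureReal_shift_le (h : RegularDensity p b ζ) {n : ℕ}
    {x : Fin n → ℝ} (hx : ∀ᵐ z ∂(noiseLaw p n), ∀ i, 0 < p (x i + z i))
    (hint : Integrable (fun z => totalSurprisal p (x + z)) (noiseLaw p n))
    {γ : ℝ} (hγ : γ ≤ 1 - ζ) {D : Set (Fin n → ℝ)} (hD : MeasurableSet D) {M : ℝ} (hM : 1 ≤ M) :
    Real.log M * (noiseLaw p n).real {z | x + z ∈ D} ≤
      (1 - γ) * ∫ z, totalSurprisal p (x + z) ∂(noiseLaw p n)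
        - n * ∫ z, surprisal p z ∂(lawOf p) + n * cgf (surprisal p) (lawOf p) γ
        + M * (Measure.pi fun _ : Fin n => (lawOf p).tilted (γ * surprisal p ·)).real D := by
  have hadd := measurable_const_add_pi x
  have hP := h.isProbabilityMeasure_noiseLaw n
  have hPm := h.isProbabilityMeasure_map x
  have hQ1 := h.isProbabilityMeasure_tilted hγ
  set Λ := cgf (surprisal p) (lawOf p) γ with hΛ
  -- The reference law is the tilted product law: its log-density is affine in the total surprisal,
  -- the one statistic of the output that the divergence constraint controls.
  set w : (Fin n → ℝ) → ℝ := fun y => Real.exp (γ * totalSurprisal p y - n * Λ) with hw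
  have hwm : Measurable w := (((h.measurable_totalSurprisal n).const_mul γ).sub_const _).exp
  have hrm : Measurable fun y => shiftDensity p x y :=
    (h.measurable_shiftDensity n).comp (measurable_const.prodMk measurable_id)
  have hmap := h.map_add_left_eq_withDensity hx
  have hpi := h.pi_tilted_eq hγ n
  have hQ : IsProbabilityMeasure ((noiseLaw p n).withDensity fun y => ENNReal.ofReal (w y)) := by
    rw [← hpi]
    infer_instance
  have hm : Measurable fun y => Real.log (shiftDensity p x y) - Real.log (w y) :=
    hrm.log.sub hwm.log
  have hae : (fun z => Real.log (shiftDensity p x (x + z)) - Real.log (w (x + z)))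
      =ᵐ[noiseLaw p n] fun z =>
        (1 - γ) * totalSurprisal p (x + z) - totalSurprisal p z + n * Λ := by
    filter_upwards [hx, h.ae_pos_noiseLaw n] with z h1 h2
    rw [RegularDensity.log_shiftDensity h2 h1, hw, Real.log_exp]
    ring
  have hi1 : Integrable (fun z => (1 - γ) * totalSurprisal p (x + z)) (noiseLaw p n) :=
    hint.const_mul _
  have hi2 : Integrable (fun z => (1 - γ) * totalSurprisal p (x + z) - totalSurprisal p z)
      (noiseLaw p n) := hi1.sub (h.integrable_totalSurprisal n)
  have hI : Integrable (fun y => Real.log (shiftDensity p x y) - Real.log (w y))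
      ((noiseLaw p n).map fun z => x + z) := by
    rw [integrable_map_measure hm.aestronglyMeasurable hadd.aemeasurable]
    exact (hi2.add (integrable_const _)).congr hae.symm
  have key := log_mul_measureReal_le (ν := noiseLaw p n) hrm (h.shiftDensity_nonneg x) hwm
    (fun y => Real.exp_pos _) (by rw [← hmap]; exact hPm) hQ (by rw [← hmap]; exact hI) hD hM
  rw [← hmap, ← hpi, map_measureReal_apply hadd hD, integral_map hadd.aemeasurable
    hm.aestronglyMeasurable, integral_congr_ae hae, integral_add hi2 (integrable_const _),
    integral_sub hi1 (h.integrable_totalSurprisal n), integral_const_mul,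
    h.integral_totalSurprisal, integral_const, probReal_univ, one_smul] at key
  exact key

theorem sum_measureReal_decode_le {n M K : ℕ} (C : Code n M K) (Q : Measure (Fin n → ℝ))
    [IsProbabilityMeasure Q] (k : Fin K) : ∑ m, Q.real {y | C.decode y k = m} ≤ 1 := by
  have hd : Pairwise (Function.onFun Disjoint fun m : Fin M => {y | C.decode y k = m}) := by
    intro m m' hne
    refine Set.disjoint_left.2 fun y h1 h2 => hne ?_
    exact h1.symm.trans h2
  rw [← measureReal_biUnion_finset (fun m _ m' _ hne => hd hne)
    fun m _ => C.measurableSet_decode k m]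
  exact measureReal_le_one

/-- Every covert and reliable code is short. -/
theorem RegularDensity.log_card_le (h : RegularDensity p b ζ) {n M : ℕ} {Δ ε : ℝ} (hΔ : 0 ≤ Δ)
    (hA : Achievable p n Δ ε M) {γ : ℝ} (hγ0 : 0 < γ) (hγ : γ ≤ 1 - ζ) :
    (1 - ε) * Real.log M ≤ n * (cgf (surprisal p) (lawOf p) γ
      - γ * ∫ z, surprisal p z ∂(lawOf p)) / γ + Δ / γ + 1 := by
  obtain ⟨hM, K, hK, C, hkl, herr⟩ := hA
  have hγ1 : γ < 1 := by linarith [h.exponent_mem.1]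
  have hP := h.isProbabilityMeasure_noiseLaw n
  have hQ1 := h.isProbabilityMeasure_tilted hγ
  have hPm := fun x : Fin n → ℝ => h.isProbabilityMeasure_map x
  set ν := noiseLaw p n with hν
  set η := C.outputLaw p with hη
  have hM' : (0 : ℝ) < M := by exact_mod_cast hM
  have hK' : (0 : ℝ) < K := by exact_mod_cast hK
  have hKM0 : (K : ℝ≥0∞) * M ≠ 0 := by
    simp only [ne_eq, mul_eq_zero, Nat.cast_eq_zero, not_or]
    omega
  have hKMt : (K : ℝ≥0∞) * M ≠ ∞ := ENNReal.mul_ne_top (by simp) (by simp)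
  have hc0 : ((K : ℝ≥0∞) * M)⁻¹ ≠ 0 := ENNReal.inv_ne_zero.2 hKMt
  have hct : ((K : ℝ≥0∞) * M)⁻¹ ≠ ∞ := ENNReal.inv_ne_top.2 hKM0
  have hηP : IsProbabilityMeasure η := by
    constructor
    simp only [hη, Code.outputLaw, Measure.smul_apply, Measure.finsetSum_apply, ← hν, measure_univ,
      smul_eq_mul, Finset.sum_const, Finset.card_univ, Fintype.card_fin, nsmul_eq_mul, mul_one]
    rw [mul_comm (M : ℝ≥0∞)]
    exact ENNReal.inv_mul_cancel hKM0 hKMt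
  have hkt : InformationTheory.klDiv η ν ≠ ∞ := (hkl.trans_lt ENNReal.ofReal_lt_top).ne
  -- Covertness enters here. The code is arbitrary, so even integrability of the total surprisal
  -- under its output law has to come from the finite divergence.
  obtain ⟨hDV1, hDV2⟩ := integrable_and_integral_le_klDiv_add_log hkt
    ((h.measurable_totalSurprisal n).const_mul γ)
    (ae_of_all _ fun y => mul_le_mul_of_nonneg_left (h.neg_mul_log_le_totalSurprisal y) hγ0.le)
    (h.integrable_exp_totalSurprisal hγ n)
  rw [h.integral_exp_totalSurprisal hγ n, Real.log_exp, integral_const_mul] at hDV2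
  have hklΔ : (InformationTheory.klDiv η ν).toReal ≤ Δ := by
    have := ENNReal.toReal_mono ENNReal.ofReal_ne_top hkl
    rwa [ENNReal.toReal_ofReal hΔ] at this
  have hgη : Integrable (fun y => totalSurprisal p y) η := by
    have := hDV1.const_mul γ⁻¹
    simpa [← mul_assoc, inv_mul_cancel₀ hγ0.ne'] using this
  have hgmk : ∀ m k, Integrable (fun y => totalSurprisal p y)
      (ν.map fun z => C.encode m k + z) := by
    intro m k
    rw [hη, Code.outputLaw, integrable_smul_measure hc0 hct, integrable_finsetSum_measure] at hgη
    have := hgη m (Finset.mem_univ m)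
    rw [integrable_finsetSum_measure] at this
    exact this k (Finset.mem_univ k)
  have hgz : ∀ m k, Integrable (fun z => totalSurprisal p (C.encode m k + z)) ν := fun m k =>
    (integrable_map_measure (h.measurable_totalSurprisal n).aestronglyMeasurable
      (measurable_const_add_pi _).aemeasurable).1 (hgmk m k)
  have hgint : ∫ y, totalSurprisal p y ∂η
      = ((K : ℝ) * M)⁻¹ * ∑ m, ∑ k, ∫ z, totalSurprisal p (C.encode m k + z) ∂ν := by
    rw [hη, Code.outputLaw, integral_smul_measure, integral_finsetSum_measure fun m _ =>
      integrable_finsetSum_measure.2 fun k _ => hgmk m k]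
    simp only [ENNReal.toReal_inv, ENNReal.toReal_mul, ENNReal.toReal_natCast, smul_eq_mul]
    congr 1
    refine Finset.sum_congr rfl fun m _ => ?_
    rw [integral_finsetSum_measure fun k _ => hgmk m k]
    refine Finset.sum_congr rfl fun k _ => ?_
    rw [integral_map (measurable_const_add_pi _).aemeasurable
      (h.measurable_totalSurprisal n).aestronglyMeasurable]
  have hac := (InformationTheory.klDiv_ne_top_iff.1 hkt).1
  -- Finite divergence forces absolute continuity of the mixture, hence of each component, since all
  -- weights are positive.
  have hpos : ∀ m k, ∀ᵐ z ∂ν, ∀ i, 0 < p (C.encode m k i + z i) := by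
    intro m k
    have h1 : ∀ᵐ y ∂η, ∀ i, 0 < p (y i) := hac.ae_le (h.ae_pos_noiseLaw n)
    rw [ae_iff, hη, Code.outputLaw, Measure.smul_apply, smul_eq_mul, mul_eq_zero,
      or_iff_right hc0, Measure.finsetSum_apply, Finset.sum_eq_zero_iff] at h1
    have h2 := h1 m (Finset.mem_univ m)
    rw [Measure.finsetSum_apply, Finset.sum_eq_zero_iff] at h2
    have h3 : ∀ᵐ y ∂(ν.map fun z => C.encode m k + z), ∀ i, 0 < p (y i) :=
      ae_iff.2 (h2 k (Finset.mem_univ k))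
    exact ae_of_ae_map (measurable_const_add_pi _).aemeasurable h3
  have hone : ∀ m k, ν.real {z | C.encode m k + z ∈ {y | C.decode y k = m}}
      = 1 - ν.real {z | C.decode (C.encode m k + z) k ≠ m} := by
    intro m k
    have hms : MeasurableSet {z | C.decode (C.encode m k + z) k = m} :=
      (measurable_const_add_pi _) (C.measurableSet_decode k m)
    have := probReal_compl_eq_one_sub (μ := ν) hms
    have h2 : {z | C.decode (C.encode m k + z) k = m}ᶜ
      = {z | C.decode (C.encode m k + z) k ≠ m} := rfl
    rw [h2] at this
    rw [this]
    simp
  set H := ∫ z, surprisal p z ∂(lawOf p) with hH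
  set Λ := cgf (surprisal p) (lawOf p) γ with hΛ
  set Q := Measure.pi fun _ : Fin n => (lawOf p).tilted (γ * surprisal p ·) with hQ
  have hmk : ∀ m k, Real.log M * (1 - ν.real {z | C.decode (C.encode m k + z) k ≠ m}) ≤
      (1 - γ) * ∫ z, totalSurprisal p (C.encode m k + z) ∂ν - n * H + n * Λ
        + M * Q.real {y | C.decode y k = m} := by
    intro m k
    rw [← hone]
    exact h.log_mul_measureReal_shift_le (hpos m k) (hgz m k) hγ (C.measurableSet_decode k m)
      (by exact_mod_cast hM)
  have hsum := Finset.sum_le_sum fun m (_ : m ∈ Finset.univ) =>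
    Finset.sum_le_sum fun k (_ : k ∈ Finset.univ) => hmk m k
  simp only [Finset.sum_add_distrib, Finset.sum_sub_distrib, ← Finset.mul_sum, mul_sub, mul_one,
    Finset.sum_const, Finset.card_univ, Fintype.card_fin, nsmul_eq_mul] at hsum
  -- The reference law does not depend on the message, so for each key the disjoint decision regions
  -- have total mass at most one. After averaging, the term `M * Q.real` costs only the additive
  -- constant `1`.
  have hQsum : ∑ m : Fin M, ∑ k : Fin K, Q.real {y | C.decode y k = m} ≤ K := by
    rw [Finset.sum_comm]
    calc _ ≤ ∑ _k : Fin K, (1 : ℝ) :=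
          Finset.sum_le_sum fun k _ => sum_measureReal_decode_le C Q k
      _ = K := by simp
  have herr' : ∑ m : Fin M, ∑ k : Fin K, ν.real {z | C.decode (C.encode m k + z) k ≠ m}
      ≤ K * M * ε := by
    rw [Code.errorProb, inv_mul_le_iff₀ (by positivity)] at herr
    exact herr
  have hG : ∑ m, ∑ k, ∫ z, totalSurprisal p (C.encode m k + z) ∂ν
      = K * M * ∫ y, totalSurprisal p y ∂η := by
    rw [hgint, mul_inv_cancel_left₀ (by positivity)]
  have hlogM : 0 ≤ Real.log M := Real.log_nonneg (by exact_mod_cast hM)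
  have hGle : ∫ y, totalSurprisal p y ∂η ≤ (Δ + n * Λ) / γ := by
    rw [le_div_iff₀ hγ0]
    linarith
  rw [hG] at hsum
  have e1 := mul_le_mul_of_nonneg_left herr' hlogM
  have e2 := mul_le_mul_of_nonneg_left hQsum hM'.le
  have e3 := mul_le_mul_of_nonneg_left hGle (sub_pos.2 hγ1).le
  have hmain : (K * M) * ((1 - ε) * Real.log M) ≤
      (K * M) * ((1 - γ) * ((Δ + n * Λ) / γ) - n * H + n * Λ + 1) := by
    have e4 := mul_le_mul_of_nonneg_left e3 (by positivity : (0 : ℝ) ≤ K * M)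
    nlinarith
  have hmain' := le_of_mul_le_mul_left hmain (by positivity)
  refine hmain'.trans ?_
  -- The bound obtained is better by `Δ`, which is discarded as it does not affect the limit.
  have : n * (Λ - γ * H) / γ + Δ / γ + 1
      = (1 - γ) * ((Δ + n * Λ) / γ) - n * H + n * Λ + 1 + Δ := by
    field_simp
    ring
  rw [this]
  linarith

end Converse

/-! ### The input law whose output is the tilted noise law -/

section Input

variable {p : ℝ → ℝ} {b ζ γ : ℝ} {μ : Measure ℝ}

/-- `μ` is an input law for which the channel output has the tilted noise law. -/
structure IsTiltingInput (p : ℝ → ℝ) (γ : ℝ) (μ : Measure ℝ) : Prop where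
  isProbabilityMeasure : IsProbabilityMeasure μ
  map_add : (μ.prod (lawOf p)).map (fun q => q.1 + q.2) = (lawOf p).tilted (γ * surprisal p ·)

theorem RegularDensity.exists_isTiltingInput (h : RegularDensity p b ζ) (hγ : γ ≤ 1 - ζ)
    (hout : IsAdditiveOutput p (tilted p γ)) : ∃ μ, IsTiltingInput p γ μ := by
  obtain ⟨Ω, _, P, X, Z, hP, hX, hZ, hind, hZl, hsum⟩ := hout
  refine ⟨P.map X, Measure.isProbabilityMeasure_map hX.aemeasurable, ?_⟩
  have hadd : Measurable fun q : ℝ × ℝ => q.1 + q.2 := measurable_fst.add measurable_snd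
  rw [← h.lawOf_tilted hγ, ← hsum, ← hZl,
    ← (indepFun_iff_map_prod_eq_prod_map_map hX.aemeasurable hZ.aemeasurable).1 hind,
    Measure.map_map hadd (hX.prodMk hZ)]
  rfl

namespace IsTiltingInput

theorem measurePreserving_coords (hμ : IsTiltingInput p γ μ) (h : RegularDensity p b ζ) (n : ℕ) :
    MeasurePreserving
    (fun q : Fin n → ℝ × ℝ => ((fun i => (q i).1, fun i => (q i).2) : (Fin n → ℝ) × (Fin n → ℝ)))
    (Measure.pi fun _ => μ.prod (lawOf p)) ((Measure.pi fun _ => μ).prod (noiseLaw p n)) := by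
  have := h.isProbabilityMeasure
  have := hμ.isProbabilityMeasure
  exact measurePreserving_arrowProdEquivProdArrow ℝ ℝ (Fin n) (fun _ => μ) (fun _ => lawOf p)

theorem measurePreserving_add (hμ : IsTiltingInput p γ μ) (h : RegularDensity p b ζ)
    (hγ : γ < 1 - ζ) (n : ℕ) :
    MeasurePreserving
    (fun q : (Fin n → ℝ) × (Fin n → ℝ) => q.1 + q.2)
    ((Measure.pi fun _ => μ).prod (noiseLaw p n))
    (Measure.pi fun _ : Fin n => (lawOf p).tilted (γ * surprisal p ·)) := by
  have := h.isProbabilityMeasure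
  have := hμ.isProbabilityMeasure
  have := h.isProbabilityMeasure_tilted hγ.le
  have hadd : Measurable fun q : ℝ × ℝ => q.1 + q.2 := measurable_fst.add measurable_snd
  have hadd' : Measurable fun q : (Fin n → ℝ) × (Fin n → ℝ) => q.1 + q.2 :=
    measurable_fst.add measurable_snd
  have hmp := hμ.measurePreserving_coords h n
  refine ⟨hadd', ?_⟩
  rw [← hmp.map_eq, Measure.map_map hadd' hmp.measurable]
  have hσ : SigmaFinite ((μ.prod (lawOf p)).map fun q => q.1 + q.2) := by
    rw [hμ.map_add]
    infer_instance
  have := Measure.pi_map_pi (μ := fun _ : Fin n => μ.prod (lawOf p))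
    (f := fun _ q => q.1 + q.2) fun _ => hadd.aemeasurable
  simp only [hμ.map_add] at this
  exact this

theorem ae_pos_add (hμ : IsTiltingInput p γ μ) (h : RegularDensity p b ζ)
    (hγ : γ < 1 - ζ) (n : ℕ) :
    ∀ᵐ q ∂((Measure.pi fun _ => μ).prod (noiseLaw p n)),
    ∀ i, 0 < p (q.1 i + q.2 i) := by
  have hac : Measure.pi (fun _ : Fin n => (lawOf p).tilted (γ * surprisal p ·)) ≪ noiseLaw p n := by
    rw [h.pi_tilted_eq hγ.le]
    exact withDensity_absolutelyContinuous _ _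
  exact (hμ.measurePreserving_add h hγ n).quasiMeasurePreserving.ae
    (hac.ae_le (h.ae_pos_noiseLaw n))

/-- The output law is a tilt of the noise law, so it does not charge zeros of `p`; by Fubini neither
does almost every individual shift. Thus `shiftDensity` is a genuine density for random codewords.
-/
theorem ae_good (hμ : IsTiltingInput p γ μ) (h : RegularDensity p b ζ)
    (hγ : γ < 1 - ζ) (n : ℕ) :
    ∀ᵐ x ∂(Measure.pi fun _ : Fin n => μ),
    ∀ᵐ z ∂(noiseLaw p n), ∀ i, 0 < p (x i + z i) := by
  have := hμ.isProbabilityMeasure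
  have := h.isProbabilityMeasure_noiseLaw n
  exact Measure.ae_ae_of_ae_prod (hμ.ae_pos_add h hγ n)

/-- The joint law of input and output has the density `shiftDensity`. -/
theorem measurePreserving_joint (hμ : IsTiltingInput p γ μ) (h : RegularDensity p b ζ)
    (hγ : γ < 1 - ζ) (n : ℕ) :
    MeasurePreserving
    (fun q : (Fin n → ℝ) × (Fin n → ℝ) => (q.1, q.1 + q.2))
    ((Measure.pi fun _ => μ).prod (noiseLaw p n))
    (((Measure.pi fun _ => μ).prod (noiseLaw p n)).withDensity fun q =>
      ENNReal.ofReal (shiftDensity p q.1 q.2)) := by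
  have := hμ.isProbabilityMeasure
  have := h.isProbabilityMeasure_noiseLaw n
  have hm : Measurable fun q : (Fin n → ℝ) × (Fin n → ℝ) => (q.1, q.1 + q.2) :=
    measurable_fst.prodMk (measurable_fst.add measurable_snd)
  have hr := (h.measurable_shiftDensity n).ennreal_ofReal
  refine ⟨hm, ?_⟩
  ext s hs
  rw [Measure.map_apply hm hs, Measure.prod_apply (hm hs), withDensity_apply _ hs,
    ← lintegral_indicator hs, lintegral_prod _ (hr.indicator hs).aemeasurable]
  refine lintegral_congr_ae ?_
  filter_upwards [hμ.ae_good h hγ n] with x hx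
  have hsx : MeasurableSet (Prod.mk x ⁻¹' s) := measurable_prodMk_left hs
  have h1 := Measure.map_apply (μ := noiseLaw p n) (measurable_const_add_pi x) hsx
  rw [h.map_add_left_eq_withDensity hx, withDensity_apply _ hsx, ← lintegral_indicator hsx] at h1
  exact h1.symm

theorem integrable_comp_joint_iff (hμ : IsTiltingInput p γ μ) (h : RegularDensity p b ζ)
    (hγ : γ < 1 - ζ) (n : ℕ)
    {F : (Fin n → ℝ) × (Fin n → ℝ) → ℝ} (hF : Measurable F) :
    Integrable (fun q => F (q.1, q.1 + q.2)) ((Measure.pi fun _ => μ).prod (noiseLaw p n)) ↔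
    Integrable (fun q => shiftDensity p q.1 q.2 * F q)
      ((Measure.pi fun _ => μ).prod (noiseLaw p n)) := by
  rw [← integrable_withDensity_ofReal_iff (h.measurable_shiftDensity n)
    fun q => h.shiftDensity_nonneg q.1 q.2]
  exact (hμ.measurePreserving_joint h hγ n).integrable_comp hF.aestronglyMeasurable

theorem integral_comp_joint (hμ : IsTiltingInput p γ μ) (h : RegularDensity p b ζ)
    (hγ : γ < 1 - ζ) (n : ℕ)
    {F : (Fin n → ℝ) × (Fin n → ℝ) → ℝ} (hF : Measurable F) :
    ∫ q, F (q.1, q.1 + q.2) ∂((Measure.pi fun _ => μ).prod (noiseLaw p n))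
      = ∫ q, shiftDensity p q.1 q.2 * F q ∂((Measure.pi fun _ => μ).prod (noiseLaw p n)) := by
  rw [← integral_withDensity_ofReal (h.measurable_shiftDensity n)
    fun q => h.shiftDensity_nonneg q.1 q.2]
  exact integral_comp_measurePreserving (hμ.measurePreserving_joint h hγ n) hF.aestronglyMeasurable

theorem memLp_surprisal_tilted (h : RegularDensity p b ζ) (hγ : γ < 1 - ζ) :
    MemLp (surprisal p) 2 ((lawOf p).tilted (γ * surprisal p ·)) := by
  have := memLp_tilted_mul (h.mem_interior_integrableExpSet hγ) 2
  exact_mod_cast this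

theorem integral_surprisal_tilted (h : RegularDensity p b ζ) (hγ : γ < 1 - ζ) :
    ∫ z, surprisal p z ∂((lawOf p).tilted (γ * surprisal p ·))
    = deriv (cgf (surprisal p) (lawOf p)) γ :=
  integral_tilted_mul_self (h.mem_interior_integrableExpSet hγ)

theorem integrable_totalSurprisal_add (hμ : IsTiltingInput p γ μ) (h : RegularDensity p b ζ)
    (hγ : γ < 1 - ζ) (n : ℕ) :
    Integrable
    (fun q : (Fin n → ℝ) × (Fin n → ℝ) => totalSurprisal p (q.1 + q.2))
    ((Measure.pi fun _ => μ).prod (noiseLaw p n)) := by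
  have := h.isProbabilityMeasure_tilted hγ.le
  refine (hμ.measurePreserving_add h hγ n).integrable_comp_of_integrable
    (g := fun y => totalSurprisal p y) (integrable_finsetSum _ fun i _ => ?_)
  exact (measurePreserving_eval (fun _ : Fin n => (lawOf p).tilted (γ * surprisal p ·))
    i).integrable_comp_of_integrable ((memLp_surprisal_tilted h hγ).integrable (by norm_num))

theorem integral_totalSurprisal_add (hμ : IsTiltingInput p γ μ) (h : RegularDensity p b ζ)
    (hγ : γ < 1 - ζ) (n : ℕ) :
    ∫ q, totalSurprisal p (q.1 + q.2) ∂((Measure.pi fun _ => μ).prod (noiseLaw p n))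
      = n * deriv (cgf (surprisal p) (lawOf p)) γ := by
  have := h.isProbabilityMeasure_tilted hγ.le
  have hmp := fun i : Fin n =>
    measurePreserving_eval (fun _ : Fin n => (lawOf p).tilted (γ * surprisal p ·)) i
  rw [integral_comp_measurePreserving (hμ.measurePreserving_add h hγ n)
    (g := fun y => totalSurprisal p y) (h.measurable_totalSurprisal n).aestronglyMeasurable]
  simp only [totalSurprisal]
  rw [integral_finsetSum (f := fun i (y : Fin n → ℝ) => surprisal p (y i)) _ fun i _ =>
    (hmp i).integrable_comp_of_integrable ((memLp_surprisal_tilted h hγ).integrable (by norm_num))]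
  have : ∀ i : Fin n, ∫ y, surprisal p (y i)
      ∂(Measure.pi fun _ : Fin n => (lawOf p).tilted (γ * surprisal p ·))
      = deriv (cgf (surprisal p) (lawOf p)) γ := fun i =>
    (integral_comp_measurePreserving (hmp i) h.measurable_surprisal.aestronglyMeasurable).trans
      (integral_surprisal_tilted h hγ)
  simp [this]

theorem integrable_totalSurprisal_noise (hμ : IsTiltingInput p γ μ) (h : RegularDensity p b ζ)
    (n : ℕ) :
    Integrable
    (fun q : (Fin n → ℝ) × (Fin n → ℝ) => totalSurprisal p q.2)
    ((Measure.pi fun _ => μ).prod (noiseLaw p n)) := by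
  have := hμ.isProbabilityMeasure
  have := h.isProbabilityMeasure_noiseLaw n
  exact (h.integrable_totalSurprisal n).comp_snd _

theorem integral_totalSurprisal_noise (hμ : IsTiltingInput p γ μ) (h : RegularDensity p b ζ)
    (n : ℕ) :
    ∫ q, totalSurprisal p q.2 ∂((Measure.pi fun _ : Fin n => μ).prod (noiseLaw p n))
      = n * ∫ z, surprisal p z ∂(lawOf p) := by
  have := hμ.isProbabilityMeasure
  have := h.isProbabilityMeasure_noiseLaw n
  rw [← h.integral_totalSurprisal n]
  exact integral_comp_measurePreserving measurePreserving_snd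
    (h.measurable_totalSurprisal n).aestronglyMeasurable

theorem ae_pos_noise (hμ : IsTiltingInput p γ μ) (h : RegularDensity p b ζ) (n : ℕ) :
    ∀ᵐ q ∂((Measure.pi fun _ : Fin n => μ).prod (noiseLaw p n)),
    ∀ i, 0 < p (q.2 i) := by
  have := hμ.isProbabilityMeasure
  have := h.isProbabilityMeasure_noiseLaw n
  exact (measurePreserving_snd (μ := Measure.pi fun _ : Fin n => μ)
    (ν := noiseLaw p n)).quasiMeasurePreserving.ae (h.ae_pos_noiseLaw n)

theorem log_shiftDensity_ae (hμ : IsTiltingInput p γ μ) (h : RegularDensity p b ζ)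
    (hγ : γ < 1 - ζ) (n : ℕ) :
    (fun q : (Fin n → ℝ) × (Fin n → ℝ) =>
      Real.log (shiftDensity p q.1 (q.1 + q.2)))
    =ᵐ[(Measure.pi fun _ => μ).prod (noiseLaw p n)]
      fun q => totalSurprisal p (q.1 + q.2) - totalSurprisal p q.2 := by
  filter_upwards [hμ.ae_pos_add h hγ n, hμ.ae_pos_noise h n] with q h1 h2
  exact RegularDensity.log_shiftDensity h2 h1

theorem integrable_mul_log_shiftDensity (hμ : IsTiltingInput p γ μ) (h : RegularDensity p b ζ)
    (hγ : γ < 1 - ζ) (n : ℕ) :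
    Integrable (fun q : (Fin n → ℝ) × (Fin n → ℝ) =>
      shiftDensity p q.1 q.2 * Real.log (shiftDensity p q.1 q.2))
    ((Measure.pi fun _ => μ).prod (noiseLaw p n)) := by
  refine (hμ.integrable_comp_joint_iff h hγ n
    (F := fun q => Real.log (shiftDensity p q.1 q.2)) (h.measurable_shiftDensity n).log).1 ?_
  refine Integrable.congr ?_ (hμ.log_shiftDensity_ae h hγ n).symm
  exact (hμ.integrable_totalSurprisal_add h hγ n).sub (hμ.integrable_totalSurprisal_noise h n)

/-- The log-density is output surprisal minus noise surprisal, whose means are `Λ'(γ)` and `H` per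
letter. This is the divergence of the joint law from independent input and noise, and it vanishes
with `γ`. -/
theorem integral_mul_log_shiftDensity (hμ : IsTiltingInput p γ μ) (h : RegularDensity p b ζ)
    (hγ : γ < 1 - ζ) (n : ℕ) :
    ∫ q, shiftDensity p q.1 q.2 *
      Real.log (shiftDensity p q.1 q.2) ∂((Measure.pi fun _ => μ).prod (noiseLaw p n))
    = n * deriv (cgf (surprisal p) (lawOf p)) γ - n * ∫ z, surprisal p z ∂(lawOf p) := by
  rw [← hμ.integral_comp_joint h hγ n
    (F := fun q => Real.log (shiftDensity p q.1 q.2)) (h.measurable_shiftDensity n).log,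
    integral_congr_ae (hμ.log_shiftDensity_ae h hγ n),
    integral_sub (hμ.integrable_totalSurprisal_add h hγ n) (hμ.integrable_totalSurprisal_noise h n),
    hμ.integral_totalSurprisal_add h hγ, hμ.integral_totalSurprisal_noise h]

theorem isChannelDensity (hμ : IsTiltingInput p γ μ) (h : RegularDensity p b ζ)
    (hγ : γ < 1 - ζ) (n : ℕ) :
    IsChannelDensity (Measure.pi fun _ : Fin n => μ) (noiseLaw p n)
    (shiftDensity p) (fun y => Real.exp
      (γ * totalSurprisal p y - n * cgf (surprisal p) (lawOf p) γ)) := by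
  have := hμ.isProbabilityMeasure
  have := h.isProbabilityMeasure_noiseLaw n
  have hwm : Measurable fun y : Fin n → ℝ => Real.exp
      (γ * totalSurprisal p y - n * cgf (surprisal p) (lawOf p) γ) :=
    (((h.measurable_totalSurprisal n).const_mul γ).sub_const _).exp
  have hr := (h.measurable_shiftDensity n).ennreal_ofReal
  refine ⟨h.measurable_shiftDensity n, h.shiftDensity_nonneg, hwm, fun y => Real.exp_pos _,
    ?_, ?_, hμ.integrable_mul_log_shiftDensity h hγ n, ?_⟩
  · filter_upwards [hμ.ae_good h hγ n] with x hx
    have h1 := (h.isProbabilityMeasure_map x).measure_univ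
    rwa [h.map_add_left_eq_withDensity hx, withDensity_apply _ MeasurableSet.univ,
      Measure.restrict_univ] at h1
  · have hr' : Measurable fun y => ∫⁻ x, ENNReal.ofReal (shiftDensity p x y)
        ∂(Measure.pi fun _ : Fin n => μ) := hr.lintegral_prod_left'
    -- The marginal density is identified by comparing two descriptions of one law: the second
    -- marginal of the joint law, and the tilted product law.
    refine (withDensity_eq_iff_of_sigmaFinite hr'.aemeasurable
      hwm.ennreal_ofReal.aemeasurable).1 ?_
    rw [← h.pi_tilted_eq hγ.le, ← (hμ.measurePreserving_add h hγ n).map_eq]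
    have hj := hμ.measurePreserving_joint h hγ n
    have h2 : (fun q : (Fin n → ℝ) × (Fin n → ℝ) => q.1 + q.2)
      = Prod.snd ∘ fun q : (Fin n → ℝ) × (Fin n → ℝ) => (q.1, q.1 + q.2) := rfl
    rw [h2, ← Measure.map_map measurable_snd hj.measurable, hj.map_eq]
    ext s hs
    rw [withDensity_apply _ hs, Measure.map_apply measurable_snd hs,
      withDensity_apply _ (measurable_snd hs), ← lintegral_indicator hs,
      ← lintegral_indicator (measurable_snd hs),
      lintegral_prod_symm _ (hr.indicator (measurable_snd hs)).aemeasurable]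
    refine lintegral_congr fun y => ?_
    by_cases hy : y ∈ s
    · rw [Set.indicator_of_mem hy]
      have hy' : ∀ x : Fin n → ℝ, (x, y) ∈ Prod.snd ⁻¹' s := fun _ => hy
      exact lintegral_congr fun x => by rw [Set.indicator_of_mem (hy' x)]
    · rw [Set.indicator_of_notMem hy]
      refine (lintegral_eq_zero_of_ae_eq_zero (ae_of_all _ fun x => ?_)).symm
      exact Set.indicator_of_notMem (a := (x, y)) (s := Prod.snd ⁻¹' s) (by exact hy) _
  · simp only [Real.log_exp]
    have hm : Measurable fun q : (Fin n → ℝ) × (Fin n → ℝ) =>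
        γ * totalSurprisal p q.2 - n * cgf (surprisal p) (lawOf p) γ :=
      (((h.measurable_totalSurprisal n).comp measurable_snd).const_mul γ).sub_const _
    refine (hμ.integrable_comp_joint_iff h hγ n hm).1 ?_
    exact ((hμ.integrable_totalSurprisal_add h hγ n).const_mul γ).sub (integrable_const _)

/-- The value is the divergence of the tilted product law from the noise law, the target for the
divergence of a random code. -/
theorem integral_mul_log_output (hμ : IsTiltingInput p γ μ) (h : RegularDensity p b ζ)
    (hγ : γ < 1 - ζ) (n : ℕ) :
    ∫ q, shiftDensity p q.1 q.2 * Real.log (Real.exp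
      (γ * totalSurprisal p q.2 - n * cgf (surprisal p) (lawOf p) γ))
      ∂((Measure.pi fun _ => μ).prod (noiseLaw p n))
    = n * (γ * deriv (cgf (surprisal p) (lawOf p)) γ - cgf (surprisal p) (lawOf p) γ) := by
  have := hμ.isProbabilityMeasure
  have := h.isProbabilityMeasure_noiseLaw n
  simp only [Real.log_exp]
  have hm : Measurable fun q : (Fin n → ℝ) × (Fin n → ℝ) =>
      γ * totalSurprisal p q.2 - n * cgf (surprisal p) (lawOf p) γ :=
    (((h.measurable_totalSurprisal n).comp measurable_snd).const_mul γ).sub_const _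
  rw [← hμ.integral_comp_joint h hγ n hm]
  simp only
  rw [integral_sub ((hμ.integrable_totalSurprisal_add h hγ n).const_mul γ) (integrable_const _),
    integral_const_mul, hμ.integral_totalSurprisal_add h hγ, integral_const, probReal_univ,
    one_smul]
  ring

end IsTiltingInput

end Input

/-! ### Concentration of the information density -/

section Concentration

/-- The part of the surprisal above a level `T` is paid for by an exponential moment, through `x² /
2 ≤ exp x` for `x ≥ 0`. -/
theorem sq_max_sub_le {s : ℝ} (hs : 0 < s) (a T : ℝ) :
    (max (a - T) 0) ^ 2 ≤ 2 / s ^ 2 * Real.exp (-(s * T)) * Real.exp (s * a) := by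
  rw [mul_assoc, ← Real.exp_add, show -(s * T) + s * a = s * (a - T) by ring]
  rcases le_total (a - T) 0 with h | h
  · rw [max_eq_right h, zero_pow two_ne_zero]
    positivity
  · rw [max_eq_left h]
    have h1 := Real.quadratic_le_exp_of_nonneg (mul_nonneg hs.le h)
    have h2 : 0 ≤ s * (a - T) := mul_nonneg hs.le h
    rw [div_mul_eq_mul_div, le_div_iff₀ (by positivity)]
    nlinarith

/-- Truncating `-log` at `T` amounts to replacing the argument by its maximum with `exp (-T)`. On
that range the logarithm is Lipschitz in the square root, with constant `2 exp (T / 2)`. -/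
theorem sq_min_neg_log_sub_le {u v : ℝ} (hu : 0 < u) (hv : 0 < v) (T : ℝ) :
    (min (-Real.log u) T - min (-Real.log v) T) ^ 2 ≤ 4 * Real.exp T * (√u - √v) ^ 2 := by
  wlog huv : u ≤ v generalizing u v
  · have := this hv hu (le_of_not_ge huv)
    rw [← neg_sub, neg_sq, ← neg_sub (√v), neg_sq (√v - √u)]
    exact this
  have hlog := Real.log_le_log hu huv
  have hnn : 0 ≤ 4 * Real.exp T * (√u - √v) ^ 2 := by positivity
  rcases le_total T (-Real.log v) with hT | hT
  · rw [min_eq_right hT, min_eq_right (by linarith)]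
    simpa using hnn
  rw [min_eq_left hT]
  set a := max u (Real.exp (-T)) with ha
  have ha0 : 0 < a := lt_max_of_lt_left hu
  have hav : a ≤ v := by
    refine max_le huv ?_
    rw [← Real.le_log_iff_exp_le hv]
    linarith
  have hmin : min (-Real.log u) T = -Real.log a := by
    rcases le_total u (Real.exp (-T)) with h | h
    · rw [ha, max_eq_right h, Real.log_exp, neg_neg, min_eq_right]
      rw [← Real.log_le_iff_le_exp hu] at h
      linarith
    · rw [ha, max_eq_left h, min_eq_left]
      rw [← Real.le_log_iff_exp_le hu] at h
      linarith
  have hsa : 0 < √a := Real.sqrt_pos.2 ha0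
  have hsv : 0 < √v := Real.sqrt_pos.2 hv
  have hsua : √u ≤ √a := Real.sqrt_le_sqrt (le_max_left _ _)
  have hsav : √a ≤ √v := Real.sqrt_le_sqrt hav
  have h1 : Real.log v - Real.log a ≤ 2 * ((√v - √a) / √a) := by
    have h2 := Real.log_le_sub_one_of_pos (x := √v / √a) (by positivity)
    rw [Real.log_div hsv.ne' hsa.ne', Real.log_sqrt hv.le, Real.log_sqrt ha0.le] at h2
    rw [sub_div, div_self hsa.ne']
    linarith
  have h0 : 0 ≤ Real.log v - Real.log a := sub_nonneg.2 (Real.log_le_log ha0 hav)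
  have hea : 1 ≤ Real.exp T * a := by
    calc (1 : ℝ) = Real.exp T * Real.exp (-T) := by rw [← Real.exp_add]; simp
      _ ≤ _ := by gcongr; exact le_max_right _ _
  rw [hmin]
  calc (-Real.log a - -Real.log v) ^ 2 = (Real.log v - Real.log a) ^ 2 := by ring
    _ ≤ (2 * ((√v - √a) / √a)) ^ 2 := pow_le_pow_left₀ h0 h1 2
    _ = 4 * (√v - √a) ^ 2 / a := by rw [mul_pow, div_pow, Real.sq_sqrt ha0.le]; ring
    _ ≤ 4 * (√v - √u) ^ 2 / a := by gcongr
    _ ≤ 4 * Real.exp T * (√u - √v) ^ 2 := by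
        rw [div_le_iff₀ ha0]
        nlinarith [sq_nonneg (√u - √v)]

/-- Both surprisals are split at `T`: the excesses are small for large `T`, and the truncated
difference is small when `√u` and `√v` are close. The constants come from `(A - B + C)² ≤ 3 (A² + B²
+ C²)`. -/
theorem sq_neg_log_sub_le {s u v : ℝ} (hs : 0 < s) (hu : 0 < u) (hv : 0 < v) (T : ℝ) :
    (-Real.log u - -Real.log v) ^ 2 ≤
      6 / s ^ 2 * Real.exp (-(s * T)) * (Real.exp (s * -Real.log u) + Real.exp (s * -Real.log v))
        + 12 * Real.exp T * (√u - √v) ^ 2 := by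
  have h1 := sq_max_sub_le hs (-Real.log u) T
  have h2 := sq_max_sub_le hs (-Real.log v) T
  have h3 := sq_min_neg_log_sub_le hu hv T
  have hsplit : ∀ x : ℝ, x = min x T + max (x - T) 0 := fun x => by
    rcases le_total x T with h | h
    · rw [min_eq_left h, max_eq_right (by linarith), add_zero]
    · rw [min_eq_right h, max_eq_left (by linarith)]
      ring
  have e1 := hsplit (-Real.log u)
  have e2 := hsplit (-Real.log v)
  set A := max (-Real.log u - T) 0
  set B := max (-Real.log v - T) 0
  set C := min (-Real.log u) T - min (-Real.log v) T with hC
  have e3 : -Real.log u - -Real.log v = A - B + C := by linarith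
  have h4 : 6 / s ^ 2 = 3 * (2 / s ^ 2) := by ring
  rw [e3, h4]
  nlinarith [sq_nonneg (A + B), sq_nonneg (A - C), sq_nonneg (B + C)]

variable {p : ℝ → ℝ} {b ζ γ : ℝ} {μ : Measure ℝ}

/-- The information density between input and output, up to a constant, in terms of input and
noise. -/
noncomputable def infoDensity (p : ℝ → ℝ) (γ : ℝ) (q : ℝ × ℝ) : ℝ :=
  (1 - γ) * surprisal p (q.1 + q.2) - surprisal p q.2

theorem RegularDensity.memLp_surprisal (h : RegularDensity p b ζ) :
    MemLp (surprisal p) 2 (lawOf p) := by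
  exact_mod_cast memLp_of_mem_interior_integrableExpSet h.zero_mem_interior 2

namespace IsTiltingInput

theorem measurePreserving_add_real (hμ : IsTiltingInput p γ μ) :
    MeasurePreserving (fun q : ℝ × ℝ => q.1 + q.2) (μ.prod (lawOf p))
      ((lawOf p).tilted (γ * surprisal p ·)) :=
  ⟨measurable_fst.add measurable_snd, hμ.map_add⟩

theorem measurePreserving_noise_real (hμ : IsTiltingInput p γ μ) (h : RegularDensity p b ζ) :
    MeasurePreserving (fun q : ℝ × ℝ => q.2) (μ.prod (lawOf p)) (lawOf p) := by
  have := hμ.isProbabilityMeasure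
  have := h.isProbabilityMeasure
  exact measurePreserving_snd

theorem memLp_infoDensity (hμ : IsTiltingInput p γ μ) (h : RegularDensity p b ζ)
    (hγ : γ < 1 - ζ) : MemLp (infoDensity p γ) 2 (μ.prod (lawOf p)) :=
  (((memLp_surprisal_tilted h hγ).comp_measurePreserving
    hμ.measurePreserving_add_real).const_mul (1 - γ)).sub
    (h.memLp_surprisal.comp_measurePreserving (hμ.measurePreserving_noise_real h))

theorem integral_infoDensity (hμ : IsTiltingInput p γ μ) (h : RegularDensity p b ζ)
    (hγ : γ < 1 - ζ) : ∫ q, infoDensity p γ q ∂(μ.prod (lawOf p))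
      = (1 - γ) * deriv (cgf (surprisal p) (lawOf p)) γ - ∫ z, surprisal p z ∂(lawOf p) := by
  have := h.isProbabilityMeasure
  have := h.isProbabilityMeasure_tilted hγ.le
  have h1 := hμ.measurePreserving_add_real
  have h2 := hμ.measurePreserving_noise_real h
  have i1 : Integrable (fun q : ℝ × ℝ => surprisal p (q.1 + q.2)) (μ.prod (lawOf p)) :=
    h1.integrable_comp_of_integrable ((memLp_surprisal_tilted h hγ).integrable (by norm_num))
  have i2 : Integrable (fun q : ℝ × ℝ => surprisal p q.2) (μ.prod (lawOf p)) :=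
    h2.integrable_comp_of_integrable h.integrable_surprisal
  simp only [infoDensity]
  rw [integral_sub (i1.const_mul _) i2, integral_const_mul,
    integral_comp_measurePreserving h1 h.measurable_surprisal.aestronglyMeasurable,
    integral_comp_measurePreserving h2 h.measurable_surprisal.aestronglyMeasurable,
    integral_surprisal_tilted h hγ]

/-- Chebyshev's inequality for the probability of the threshold event. -/
theorem lintegral_threshold_le (hμ : IsTiltingInput p γ μ) (h : RegularDensity p b ζ)
    (hγ : γ < 1 - ζ) (n : ℕ) {t c : ℝ} (ht : 0 < t) (hc : 0 < c)
    (htc : Real.log t + c ≤ n * (∫ q, infoDensity p γ q ∂(μ.prod (lawOf p))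
      + cgf (surprisal p) (lawOf p) γ)) :
    ∫⁻ q in {q : (Fin n → ℝ) × (Fin n → ℝ) | shiftDensity p q.1 q.2 ≤ t * Real.exp
        (γ * totalSurprisal p q.2 - n * cgf (surprisal p) (lawOf p) γ)},
      ENNReal.ofReal (shiftDensity p q.1 q.2) ∂((Measure.pi fun _ => μ).prod (noiseLaw p n))
    ≤ ENNReal.ofReal (n * Var[infoDensity p γ; μ.prod (lawOf p)] / c ^ 2) := by
  have := hμ.isProbabilityMeasure
  have := h.isProbabilityMeasure
  have := h.isProbabilityMeasure_noiseLaw n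
  have hset := (hμ.isChannelDensity h hγ n).measurableSet_le_mul t
  have hj := hμ.measurePreserving_joint h hγ n
  have hco := hμ.measurePreserving_coords h n
  have hmem := hμ.memLp_infoDensity h hγ
  set Λ := cgf (surprisal p) (lawOf p) γ with hΛ
  set I := ∫ q, infoDensity p γ q ∂(μ.prod (lawOf p)) with hI
  set P := Measure.pi fun _ : Fin n => μ.prod (lawOf p) with hP
  set S : (Fin n → ℝ × ℝ) → ℝ := ∑ i, fun q => infoDensity p γ (q i) with hS
  have hmp := fun i : Fin n => measurePreserving_eval (fun _ : Fin n => μ.prod (lawOf p)) i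
  have hSmem : MemLp S 2 P :=
    memLp_finsetSum' _ fun i _ => hmem.comp_measurePreserving (hmp i)
  have hSvar : Var[S; P] = n * Var[infoDensity p γ; μ.prod (lawOf p)] := by
    rw [hS, hP, variance_sum_pi fun _ => hmem]
    simp
  have hSint : ∫ q, S q ∂P = n * I := by
    simp only [hS, Finset.sum_apply]
    rw [integral_finsetSum (f := fun i (q : Fin n → ℝ × ℝ) => infoDensity p γ (q i)) _ fun i _ =>
      (hmp i).integrable_comp_of_integrable (hmem.integrable (by norm_num))]
    have : ∀ i : Fin n, ∫ q, infoDensity p γ (q i) ∂P = I := fun i =>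
      integral_comp_measurePreserving (hmp i) hmem.1
    refine (Finset.sum_congr rfl fun i _ => this i).trans ?_
    rw [Finset.sum_const, Finset.card_univ, Fintype.card_fin, nsmul_eq_mul]
  rw [← withDensity_apply _ hset, ← hj.map_eq, Measure.map_apply hj.measurable hset,
    ← hco.map_eq, Measure.map_apply hco.measurable (hj.measurable hset), ← hSvar]
  refine le_trans (measure_mono_ae ?_) (meas_ge_le_variance_div_sq hSmem hc)
  filter_upwards [hco.quasiMeasurePreserving.ae (hμ.ae_pos_add h hγ n),
    hco.quasiMeasurePreserving.ae (hμ.ae_pos_noise h n)] with q h1 h2 hq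
  have hq' : shiftDensity p (fun i => (q i).1) ((fun i => (q i).1) + fun i => (q i).2) ≤
      t * Real.exp (γ * totalSurprisal p ((fun i => (q i).1) + fun i => (q i).2) - n * Λ) := hq
  have hlog := RegularDensity.log_shiftDensity (p := p) (x := fun i => (q i).1)
    (z := fun i => (q i).2) h2 h1
  have hpos : 0 < shiftDensity p (fun i => (q i).1) ((fun i => (q i).1) + fun i => (q i).2) := by
    simp only [shiftDensity, Pi.add_apply, add_sub_cancel_left]
    exact div_pos (Finset.prod_pos fun i _ => h2 i) (Finset.prod_pos fun i _ => h1 i)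
  have h3 := Real.log_le_log hpos hq'
  rw [hlog, Real.log_mul ht.ne' (Real.exp_pos _).ne', Real.log_exp] at h3
  have hSq : S q = (1 - γ) * totalSurprisal p ((fun i => (q i).1) + fun i => (q i).2)
      - totalSurprisal p (fun i => (q i).2) := by
    simp only [hS, Finset.sum_apply, infoDensity, totalSurprisal, Finset.sum_sub_distrib,
      Finset.mul_sum, Pi.add_apply]
  change c ≤ |S q - ∫ q, S q ∂P|
  rw [hSint]
  refine le_trans ?_ (neg_le_abs _)
  rw [hSq]
  linarith

/-- With `r` the one-letter shift density at the output `y`, the integrand under the joint law is `r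
p(y) (1 - √r)²`. Here `r p(y) = p(y - x) ≤ b`, and `(1 - √r)² ≤ r log r + 1 - r` is the comparison
of squared Hellinger distance with divergence. -/
theorem integral_sq_sqrt_sub_le (hμ : IsTiltingInput p γ μ) (h : RegularDensity p b ζ)
    (hγ : γ < 1 - ζ) :
    ∫ q, (√(p (q.1 + q.2)) - √(p q.2)) ^ 2 ∂(μ.prod (lawOf p)) ≤
      b * (deriv (cgf (surprisal p) (lawOf p)) γ - ∫ z, surprisal p z ∂(lawOf p)) := by
  have := hμ.isProbabilityMeasure
  have := h.isProbabilityMeasure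
  have := h.isProbabilityMeasure_noiseLaw 1
  have hmp : MeasurePreserving (fun q : (Fin 1 → ℝ) × (Fin 1 → ℝ) => (q.1 0, q.2 0))
      ((Measure.pi fun _ => μ).prod (noiseLaw p 1)) (μ.prod (lawOf p)) :=
    (measurePreserving_eval (fun _ : Fin 1 => μ) 0).prod
      (measurePreserving_eval (fun _ : Fin 1 => lawOf p) 0)
  have hm1 : Measurable fun q : ℝ × ℝ => (√(p (q.1 + q.2)) - √(p q.2)) ^ 2 :=
    (((h.measurable.comp (measurable_fst.add measurable_snd)).sqrt).sub
      (h.measurable.comp measurable_snd).sqrt).pow_const 2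
  have hm2 : Measurable fun q : (Fin 1 → ℝ) × (Fin 1 → ℝ) =>
      (√(p (q.2 0)) - √(p (q.2 0 - q.1 0))) ^ 2 := by
    have e1 : Measurable fun q : (Fin 1 → ℝ) × (Fin 1 → ℝ) => q.2 0 :=
      (measurable_pi_apply 0).comp measurable_snd
    have e2 : Measurable fun q : (Fin 1 → ℝ) × (Fin 1 → ℝ) => q.1 0 :=
      (measurable_pi_apply 0).comp measurable_fst
    exact ((h.measurable.comp e1).sqrt.sub (h.measurable.comp (e1.sub e2)).sqrt).pow_const 2
  have hch := hμ.isChannelDensity h hγ 1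
  have hlog := hμ.integrable_mul_log_shiftDensity h hγ 1
  have hlog' := hμ.integral_mul_log_shiftDensity h hγ 1
  rw [← integral_comp_measurePreserving hmp hm1.aestronglyMeasurable]
  have hj := hμ.integral_comp_joint h hγ 1 hm2
  simp only [Pi.add_apply, add_sub_cancel_left] at hj
  simp only
  rw [hj]
  have i2 : Integrable (fun q : (Fin 1 → ℝ) × (Fin 1 → ℝ) =>
      shiftDensity p q.1 q.2 * Real.log (shiftDensity p q.1 q.2) + 1)
      ((Measure.pi fun _ => μ).prod (noiseLaw p 1)) := hlog.add (integrable_const _)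
  calc _ ≤ ∫ q, b * (shiftDensity p q.1 q.2 * Real.log (shiftDensity p q.1 q.2) + 1
        - shiftDensity p q.1 q.2) ∂((Measure.pi fun _ => μ).prod (noiseLaw p 1)) := by
        refine integral_mono_of_nonneg
          (ae_of_all _ fun q => mul_nonneg (h.shiftDensity_nonneg _ _) (sq_nonneg _))
          ((i2.sub hch.integrable).const_mul b) ?_
        filter_upwards [hμ.ae_pos_noise h 1] with q hq
        have hr0 := h.shiftDensity_nonneg q.1 q.2
        have hp := hq 0
        have hr : p (q.2 0 - q.1 0) = shiftDensity p q.1 q.2 * p (q.2 0) := by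
          simp [shiftDensity, hp.ne']
        set r := shiftDensity p q.1 q.2
        have hb : r * p (q.2 0) ≤ b := hr ▸ h.le_bound _
        rw [hr, Real.sqrt_mul hr0]
        have e1 : r * (√(p (q.2 0)) - √r * √(p (q.2 0))) ^ 2 = r * p (q.2 0) * (1 - √r) ^ 2 := by
          have := Real.sq_sqrt hp.le
          calc _ = r * (√(p (q.2 0)) ^ 2) * (1 - √r) ^ 2 := by ring
            _ = _ := by rw [this]
        have e2 : (1 - √r) ^ 2 ≤ r * Real.log r + 1 - r := by
          rcases hr0.eq_or_lt with h0 | h0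
          · simp [← h0]
          · have hs : 0 < √r := Real.sqrt_pos.2 h0
            have h1 := Real.one_sub_inv_le_log_of_pos hs
            rw [Real.log_sqrt h0.le] at h1
            have h2 := mul_le_mul_of_nonneg_left h1 h0.le
            have h3 : r * (1 - (√r)⁻¹) = r - √r := by
              rw [mul_sub, mul_one]
              congr 1
              nth_rw 1 [← Real.mul_self_sqrt h0.le]
              rw [mul_assoc, mul_inv_cancel₀ hs.ne', mul_one]
            have h4 := Real.sq_sqrt h0.le
            nlinarith
        rw [e1]
        exact (mul_le_mul_of_nonneg_right hb (sq_nonneg _)).trans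
          (mul_le_mul_of_nonneg_left e2 (by linarith [h.one_le]))
    _ = _ := by
        rw [integral_const_mul, integral_sub i2 hch.integrable, integral_add hlog
          (integrable_const _), hlog', hch.integral_eq_one]
        simp

theorem integral_exp_surprisal_tilted (h : RegularDensity p b ζ) {s : ℝ} (hγ : γ ≤ 1 - ζ)
    (hs : s + γ ≤ 1 - ζ) :
    Integrable (fun z => Real.exp (s * surprisal p z)) ((lawOf p).tilted (γ * surprisal p ·)) ∧
    ∫ z, Real.exp (s * surprisal p z) ∂((lawOf p).tilted (γ * surprisal p ·))
      = Real.exp (cgf (surprisal p) (lawOf p) (s + γ) - cgf (surprisal p) (lawOf p) γ) := by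
  have hadd : ∀ z, Real.exp (γ * surprisal p z) * Real.exp (s * surprisal p z)
      = Real.exp ((s + γ) * surprisal p z) := fun z => by rw [← Real.exp_add]; ring_nf
  constructor
  · rw [integrable_tilted_iff (h.integrable_exp_surprisal hγ)]
    simp only [smul_eq_mul, hadd]
    exact h.integrable_exp_surprisal hs
  · rw [integral_exp_tilted, h.integral_exp_surprisal hγ, Real.exp_sub,
      ← h.integral_exp_surprisal hs]
    congr 2
    funext z
    simp only [Pi.add_apply]
    ring_nf

/-- The variance of the information density is small for a small tilt. -/
theorem variance_infoDensity_le (hμ : IsTiltingInput p γ μ) (h : RegularDensity p b ζ)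
    {s : ℝ} (hs0 : 0 < s) (hγ : γ < 1 - ζ) (hs : s ≤ 1 - ζ) (hsγ : s + γ ≤ 1 - ζ) (T : ℝ) :
    Var[infoDensity p γ; μ.prod (lawOf p)] ≤
      2 * (6 / s ^ 2 * Real.exp (-(s * T)) *
          (Real.exp (cgf (surprisal p) (lawOf p) (s + γ) - cgf (surprisal p) (lawOf p) γ)
            + Real.exp (cgf (surprisal p) (lawOf p) s))
        + 12 * Real.exp T * (b * (deriv (cgf (surprisal p) (lawOf p)) γ
            - ∫ z, surprisal p z ∂(lawOf p))))
      + 2 * γ ^ 2 * (iteratedDeriv 2 (cgf (surprisal p) (lawOf p)) γ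
        + deriv (cgf (surprisal p) (lawOf p)) γ ^ 2) := by
  have := hμ.isProbabilityMeasure
  have := h.isProbabilityMeasure
  have := h.isProbabilityMeasure_tilted hγ.le
  have h1 := hμ.measurePreserving_add_real
  have h2 := hμ.measurePreserving_noise_real h
  have hLm := h.measurable_surprisal
  obtain ⟨ie, ve⟩ := integral_exp_surprisal_tilted h hγ.le hsγ
  have iW : Integrable (fun q : ℝ × ℝ => Real.exp (s * surprisal p (q.1 + q.2)))
      (μ.prod (lawOf p)) := h1.integrable_comp_of_integrable ie
  have iU : Integrable (fun q : ℝ × ℝ => Real.exp (s * surprisal p q.2)) (μ.prod (lawOf p)) :=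
    h2.integrable_comp_of_integrable (h.integrable_exp_surprisal hs)
  have vW := (integral_comp_measurePreserving h1 ie.1).trans ve
  have vU := (integral_comp_measurePreserving h2
    (h.integrable_exp_surprisal hs).1).trans (h.integral_exp_surprisal hs)
  have hq := memLp_surprisal_tilted h hγ
  have iS : Integrable (fun q : ℝ × ℝ => surprisal p (q.1 + q.2) ^ 2) (μ.prod (lawOf p)) :=
    h1.integrable_comp_of_integrable hq.integrable_sq
  have vS : ∫ q, surprisal p (q.1 + q.2) ^ 2 ∂(μ.prod (lawOf p)) =
      iteratedDeriv 2 (cgf (surprisal p) (lawOf p)) γ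
        + deriv (cgf (surprisal p) (lawOf p)) γ ^ 2 := by
    have e1 := integral_comp_measurePreserving h1 (hLm.pow_const 2).aestronglyMeasurable
    have e2 := variance_tilted_mul (h.mem_interior_integrableExpSet hγ)
    rw [variance_eq_sub hq, integral_surprisal_tilted h hγ] at e2
    rw [e1, ← e2]
    simp
  have iD : Integrable (fun q : ℝ × ℝ => (√(p (q.1 + q.2)) - √(p q.2)) ^ 2)
      (μ.prod (lawOf p)) := by
    have hm : Measurable fun q : ℝ × ℝ => (√(p (q.1 + q.2)) - √(p q.2)) ^ 2 :=
      (((h.measurable.comp (measurable_fst.add measurable_snd)).sqrt).sub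
        (h.measurable.comp measurable_snd).sqrt).pow_const 2
    refine (integrable_const b).mono' hm.aestronglyMeasurable (ae_of_all _ fun q => ?_)
    rw [Real.norm_of_nonneg (sq_nonneg _)]
    have a1 := Real.sq_sqrt (h.nonneg (q.1 + q.2))
    have a2 := Real.sq_sqrt (h.nonneg q.2)
    have a3 := h.le_bound (q.1 + q.2)
    have a4 := h.le_bound q.2
    have a5 := Real.sqrt_nonneg (p (q.1 + q.2))
    have a6 := Real.sqrt_nonneg (p q.2)
    rcases le_total (√(p (q.1 + q.2))) (√(p q.2)) with hle | hle <;> nlinarith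
  have vD := hμ.integral_sq_sqrt_sub_le h hγ
  have hpos1 : ∀ᵐ q ∂(μ.prod (lawOf p)), 0 < p (q.1 + q.2) :=
    h1.quasiMeasurePreserving.ae ((tilted_absolutelyContinuous _ _).ae_le h.ae_pos)
  have hpos2 : ∀ᵐ q ∂(μ.prod (lawOf p)), 0 < p q.2 := h2.quasiMeasurePreserving.ae h.ae_pos
  have iWU : Integrable (fun q : ℝ × ℝ => 6 / s ^ 2 * Real.exp (-(s * T)) *
      (Real.exp (s * surprisal p (q.1 + q.2)) + Real.exp (s * surprisal p q.2)))
      (μ.prod (lawOf p)) := (iW.add iU).const_mul _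
  have iWUD : Integrable (fun q : ℝ × ℝ => 6 / s ^ 2 * Real.exp (-(s * T)) *
      (Real.exp (s * surprisal p (q.1 + q.2)) + Real.exp (s * surprisal p q.2))
      + 12 * Real.exp T * (√(p (q.1 + q.2)) - √(p q.2)) ^ 2) (μ.prod (lawOf p)) :=
    iWU.add (iD.const_mul _)
  -- The uncentred second moment suffices. The information density is the difference of output and
  -- noise surprisals minus `γ` times the output surprisal, and `(A - B)² ≤ 2 A² + 2 B²` separates
  -- the two.
  refine (variance_le_expectation_sq (hμ.memLp_infoDensity h hγ).1).trans ?_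
  calc _ ≤ ∫ q, (2 * (6 / s ^ 2 * Real.exp (-(s * T)) *
        (Real.exp (s * surprisal p (q.1 + q.2)) + Real.exp (s * surprisal p q.2))
        + 12 * Real.exp T * (√(p (q.1 + q.2)) - √(p q.2)) ^ 2)
        + 2 * γ ^ 2 * surprisal p (q.1 + q.2) ^ 2) ∂(μ.prod (lawOf p)) := by
        refine integral_mono_of_nonneg (ae_of_all _ fun q => sq_nonneg _)
          ((iWUD.const_mul 2).add (iS.const_mul _)) ?_
        filter_upwards [hpos1, hpos2] with q k1 k2
        have key := sq_neg_log_sub_le hs0 k1 k2 T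
        simp only [Pi.pow_apply, infoDensity]
        simp only [surprisal] at key ⊢
        nlinarith [sq_nonneg (-Real.log (p (q.1 + q.2)) - -Real.log (p q.2)
          + γ * -Real.log (p (q.1 + q.2)))]
    _ = 2 * (6 / s ^ 2 * Real.exp (-(s * T)) *
          (Real.exp (cgf (surprisal p) (lawOf p) (s + γ) - cgf (surprisal p) (lawOf p) γ)
            + Real.exp (cgf (surprisal p) (lawOf p) s))
        + 12 * Real.exp T * ∫ q, (√(p (q.1 + q.2)) - √(p q.2)) ^ 2 ∂(μ.prod (lawOf p)))
      + 2 * γ ^ 2 * (iteratedDeriv 2 (cgf (surprisal p) (lawOf p)) γ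
        + deriv (cgf (surprisal p) (lawOf p)) γ ^ 2) := by
        rw [integral_add (iWUD.const_mul 2) (iS.const_mul _), integral_const_mul,
          integral_add iWU (iD.const_mul _), integral_const_mul, integral_add iW iU,
          integral_const_mul, integral_const_mul, vW, vU, vS]
    _ ≤ _ := by gcongr

end IsTiltingInput

end Concentration

/-! ### Second-order expansion of the cumulant generating function at zero -/

section Expansion

variable {p : ℝ → ℝ} {b ζ : ℝ}

namespace RegularDensity

theorem analyticAt_cgf (h : RegularDensity p b ζ) {t : ℝ} (ht : t < 1 - ζ) :
    AnalyticAt ℝ (cgf (surprisal p) (lawOf p)) t :=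
  ProbabilityTheory.analyticAt_cgf (h.mem_interior_integrableExpSet ht)

theorem deriv_cgf_zero (h : RegularDensity p b ζ) :
    deriv (cgf (surprisal p) (lawOf p)) 0 = ∫ z, surprisal p z ∂(lawOf p) := by
  have := h.isProbabilityMeasure
  rw [ProbabilityTheory.deriv_cgf_zero h.zero_mem_interior]
  simp

theorem deriv_deriv_cgf_zero (h : RegularDensity p b ζ) :
    deriv (deriv (cgf (surprisal p) (lawOf p))) 0 = Var[surprisal p; lawOf p] := by
  have := h.isProbabilityMeasure
  have h1 := iteratedDeriv_two_cgf h.zero_mem_interior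
  rw [iteratedDeriv_succ, iteratedDeriv_one, h.deriv_cgf_zero] at h1
  rw [h1, variance_eq_sub h.memLp_surprisal]
  simp

theorem zero_lt_one_sub (h : RegularDensity p b ζ) : 0 < 1 - ζ := by
  linarith [h.exponent_mem.2]

theorem tendsto_deriv_cgf_slope (h : RegularDensity p b ζ) :
    Tendsto (fun γ => (deriv (cgf (surprisal p) (lawOf p)) γ - ∫ z, surprisal p z ∂(lawOf p)) / γ)
      (𝓝[>] 0) (𝓝 (Var[surprisal p; lawOf p])) := by
  have hd := (h.analyticAt_cgf h.zero_lt_one_sub).deriv.differentiableAt.hasDerivAt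
  rw [h.deriv_deriv_cgf_zero] at hd
  have := hd.tendsto_slope.mono_left (nhdsWithin_mono 0 fun x hx => ne_of_gt hx)
  refine this.congr fun γ => ?_
  rw [slope_def_field, h.deriv_cgf_zero, sub_zero]

theorem tendsto_cgf_second_order (h : RegularDensity p b ζ) :
    Tendsto (fun γ => (cgf (surprisal p) (lawOf p) γ - γ * ∫ z, surprisal p z ∂(lawOf p)) / γ ^ 2)
      (𝓝[>] 0) (𝓝 (Var[surprisal p; lawOf p] / 2)) := by
  have := h.isProbabilityMeasure
  set f := cgf (surprisal p) (lawOf p) with hf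
  set H := ∫ z, surprisal p z ∂(lawOf p)
  have hev : ∀ᶠ γ in 𝓝[>] (0 : ℝ), γ < 1 - ζ :=
    mem_nhdsWithin_of_mem_nhds (Iio_mem_nhds h.zero_lt_one_sub)
  have hf0 : f 0 = 0 := cgf_zero
  refine HasDerivAt.lhopital_zero_nhdsGT (f' := fun γ => deriv f γ - H) (g' := fun γ => 2 * γ)
    ?_ ?_ ?_ ?_ ?_ ?_
  · filter_upwards [hev] with γ hγ
    exact (h.analyticAt_cgf hγ).differentiableAt.hasDerivAt.sub (hasDerivAt_mul_const H)
  · exact Eventually.of_forall fun γ => by simpa using hasDerivAt_pow 2 γ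
  · filter_upwards [self_mem_nhdsWithin] with γ hγ
    exact mul_ne_zero two_ne_zero (ne_of_gt hγ)
  · have hc : ContinuousAt (fun γ => f γ - γ * H) 0 :=
      (h.analyticAt_cgf h.zero_lt_one_sub).continuousAt.sub (by fun_prop)
    have := hc.tendsto.mono_left (nhdsWithin_le_nhds (s := Set.Ioi 0))
    simpa [hf0] using this
  · have hc : ContinuousAt (fun γ : ℝ => γ ^ 2) 0 := by fun_prop
    have := hc.tendsto.mono_left (nhdsWithin_le_nhds (s := Set.Ioi 0))
    simpa using this
  · refine (h.tendsto_deriv_cgf_slope.div_const 2).congr fun γ => ?_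
    rw [div_div, mul_comm γ]

/-- The divergence of the tilted law, to second order. -/
theorem tendsto_divergence (h : RegularDensity p b ζ) :
    Tendsto (fun γ => (γ * deriv (cgf (surprisal p) (lawOf p)) γ - cgf (surprisal p) (lawOf p) γ)
      / γ ^ 2) (𝓝[>] 0) (𝓝 (Var[surprisal p; lawOf p] / 2)) := by
  have := h.tendsto_deriv_cgf_slope.sub h.tendsto_cgf_second_order
  rw [sub_half] at this
  refine this.congr' ?_
  filter_upwards [self_mem_nhdsWithin] with γ hγ
  have : γ ≠ 0 := ne_of_gt hγ
  field_simp
  ring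

/-- The mutual information of the tilting input, to first order. -/
theorem tendsto_information (h : RegularDensity p b ζ) :
    Tendsto (fun γ => ((1 - γ) * deriv (cgf (surprisal p) (lawOf p)) γ
      - ∫ z, surprisal p z ∂(lawOf p) + cgf (surprisal p) (lawOf p) γ) / γ)
      (𝓝[>] 0) (𝓝 (Var[surprisal p; lawOf p])) := by
  have := h.isProbabilityMeasure
  set f := cgf (surprisal p) (lawOf p) with hf
  set H := ∫ z, surprisal p z ∂(lawOf p) with hH
  have hf0 : f 0 = 0 := cgf_zero
  have hd := (h.analyticAt_cgf h.zero_lt_one_sub).differentiableAt.hasDerivAt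
  rw [h.deriv_cgf_zero] at hd
  have h1 := hd.tendsto_slope.mono_left
    (nhdsWithin_mono 0 fun x (hx : x ∈ Set.Ioi 0) => ne_of_gt hx)
  have h2 : Tendsto (deriv f) (𝓝[>] 0) (𝓝 H) := by
    have := (h.analyticAt_cgf h.zero_lt_one_sub).deriv.continuousAt.tendsto.mono_left
      (nhdsWithin_le_nhds (s := Set.Ioi 0))
    rwa [h.deriv_cgf_zero] at this
  have h3 := (h.tendsto_deriv_cgf_slope.sub h2).add h1
  rw [sub_add_cancel] at h3
  refine h3.congr' ?_
  filter_upwards [self_mem_nhdsWithin] with γ hγ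
  have : γ ≠ 0 := ne_of_gt hγ
  rw [slope_def_field, ← hf, hf0]
  field_simp
  ring

/-- The order of choices matters: first `T` is fixed so large that the tail term is below `ρ`, and
only then `γ` tends to zero, which removes the terms carrying the factor `exp T` or `γ²`. -/
theorem eventually_variance_le (h : RegularDensity p b ζ) {ρ : ℝ} (hρ : 0 < ρ) :
    ∀ᶠ γ in 𝓝[>] (0 : ℝ), ∀ μ, IsTiltingInput p γ μ →
      Var[infoDensity p γ; μ.prod (lawOf p)] ≤ ρ := by
  have := h.isProbabilityMeasure
  set f := cgf (surprisal p) (lawOf p) with hf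
  -- Half of the available range, so that `s + γ` remains admissible for every `γ < s`.
  set s := (1 - ζ) / 2 with hs
  have hs0 : 0 < s := by linarith [h.zero_lt_one_sub]
  have hf0 : f 0 = 0 := cgf_zero
  obtain ⟨T, hT⟩ : ∃ T : ℝ, 2 * (6 / s ^ 2 * Real.exp (-(s * T)) *
      (Real.exp (f s) + Real.exp (f s))) < ρ := by
    have h1 : Tendsto (fun T : ℝ => 2 * (6 / s ^ 2 * Real.exp (-(s * T)) *
        (Real.exp (f s) + Real.exp (f s)))) atTop
        (𝓝 (2 * (6 / s ^ 2 * 0 * (Real.exp (f s) + Real.exp (f s))))) :=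
      (((Real.tendsto_exp_neg_atTop_nhds_zero.comp
        (tendsto_id.const_mul_atTop hs0)).const_mul _).mul_const _).const_mul _
    rw [mul_zero, zero_mul, mul_zero] at h1
    exact (h1.eventually_lt_const hρ).exists
  have hcont : ContinuousAt (fun γ => 2 * (6 / s ^ 2 * Real.exp (-(s * T)) *
          (Real.exp (f (s + γ) - f γ) + Real.exp (f s))
        + 12 * Real.exp T * (b * (deriv f γ - ∫ z, surprisal p z ∂(lawOf p))))
      + 2 * γ ^ 2 * (iteratedDeriv 2 f γ + deriv f γ ^ 2)) 0 := by
    have c0 := (h.analyticAt_cgf h.zero_lt_one_sub).continuousAt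
    have c1 := (h.analyticAt_cgf h.zero_lt_one_sub).deriv.continuousAt
    have c2 : ContinuousAt (iteratedDeriv 2 f) 0 := by
      rw [iteratedDeriv_succ, iteratedDeriv_one]
      exact (h.analyticAt_cgf h.zero_lt_one_sub).deriv.deriv.continuousAt
    have c3 : ContinuousAt (fun γ => f (s + γ)) 0 := by
      have : ContinuousAt f (s + 0) := by
        rw [add_zero]
        exact (h.analyticAt_cgf (by linarith)).continuousAt
      exact ContinuousAt.comp (f := fun γ : ℝ => s + γ) this (by fun_prop)
    exact (((((c3.sub c0).rexp.add continuousAt_const).const_mul _).add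
      ((c1.sub continuousAt_const).const_mul b |>.const_mul _)).const_mul 2).add
      (((continuousAt_id.pow 2).const_mul 2).mul (c2.add (c1.pow 2)))
  have hf1 : deriv f 0 = ∫ z, surprisal p z ∂(lawOf p) := h.deriv_cgf_zero
  have hlim := hcont.tendsto.mono_left (nhdsWithin_le_nhds (s := Set.Ioi 0))
  simp only [add_zero, hf0, sub_zero, hf1, sub_self, mul_zero, ne_eq,
    OfNat.ofNat_ne_zero, not_false_eq_true, zero_pow, zero_mul] at hlim
  filter_upwards [hlim.eventually_lt_const hT, mem_nhdsWithin_of_mem_nhds (Iio_mem_nhds hs0)]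
    with γ h1 h2 μ hμ
  have h2' : γ < s := h2
  exact (hμ.variance_infoDensity_le h hs0 (by linarith) (by linarith) (by linarith) T).trans h1.le

end RegularDensity

end Expansion

/-! ### Achievability for a fixed block length -/

section Achievability

variable {p : ℝ → ℝ} {b ζ : ℝ}

theorem klDiv_withDensity_ofReal {Y : Type*} [MeasurableSpace Y] {ν : Measure Y}
    [IsProbabilityMeasure ν] {g : Y → ℝ} (hg : Measurable g) (hg0 : ∀ y, 0 ≤ g y)
    (hfin : IsFiniteMeasure (ν.withDensity fun y => ENNReal.ofReal (g y))) :
    InformationTheory.klDiv (ν.withDensity fun y => ENNReal.ofReal (g y)) ν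
      = ∫⁻ y, ENNReal.ofReal (InformationTheory.klFun (g y)) ∂ν := by
  rw [InformationTheory.klDiv_eq_lintegral_klFun_of_ac (withDensity_absolutelyContinuous _ _)]
  refine lintegral_congr_ae ?_
  filter_upwards [Measure.rnDeriv_withDensity ν hg.ennreal_ofReal] with y hy
  rw [hy, ENNReal.toReal_ofReal (hg0 y)]

theorem RegularDensity.outputLaw_eq (h : RegularDensity p b ζ) {n M K : ℕ} (C : Code n M K)
    (hgood : ∀ m k, ∀ᵐ z ∂(noiseLaw p n), ∀ i, 0 < p (C.encode m k i + z i)) :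
    C.outputLaw p = (noiseLaw p n).withDensity fun y => ENNReal.ofReal
      (((Fintype.card (Fin M × Fin K) : ℕ) : ℝ)⁻¹ *
        ∑ j : Fin M × Fin K, shiftDensity p (C.encode j.1 j.2) y) := by
  have hm : ∀ j : Fin M × Fin K, Measurable fun y =>
      ENNReal.ofReal (shiftDensity p (C.encode j.1 j.2) y) := fun j =>
    ((h.measurable_shiftDensity n).comp (measurable_const.prodMk measurable_id)).ennreal_ofReal
  have h1 : (fun y => ENNReal.ofReal (((Fintype.card (Fin M × Fin K) : ℕ) : ℝ)⁻¹ *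
        ∑ j : Fin M × Fin K, shiftDensity p (C.encode j.1 j.2) y))
      = (ENNReal.ofReal (((Fintype.card (Fin M × Fin K) : ℕ) : ℝ)⁻¹)) • fun y =>
        ∑ j : Fin M × Fin K, ENNReal.ofReal (shiftDensity p (C.encode j.1 j.2) y) := by
    funext y
    rw [ENNReal.ofReal_mul (by positivity),
      ENNReal.ofReal_sum_of_nonneg fun j _ => h.shiftDensity_nonneg _ _]
    rfl
  have h2 : ∀ s : Finset (Fin M × Fin K), ((noiseLaw p n).withDensity fun y =>
      ∑ j ∈ s, ENNReal.ofReal (shiftDensity p (C.encode j.1 j.2) y))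
      = ∑ j ∈ s, (noiseLaw p n).map fun z => C.encode j.1 j.2 + z := by
    intro s
    induction s using Finset.cons_induction with
    | empty => simp
    | cons j s hj ih =>
      simp only [Finset.sum_cons]
      rw [← ih, h.map_add_left_eq_withDensity (hgood j.1 j.2), ← withDensity_add_left (hm j)]
      rfl
  rw [h1, withDensity_smul _ (Finset.measurable_fun_sum _ fun j _ => hm j), h2, Code.outputLaw,
    ← Finset.sum_product', Finset.univ_product_univ]
  rcases Nat.eq_zero_or_pos (Fintype.card (Fin M × Fin K)) with h0 | h0
  · have : IsEmpty (Fin M × Fin K) := Fintype.card_eq_zero_iff.1 h0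
    simp
  · rw [ENNReal.ofReal_inv_of_pos (by exact_mod_cast h0), ENNReal.ofReal_natCast]
    simp [mul_comm]

theorem RegularDensity.errorProb_eq (h : RegularDensity p b ζ) {n M K : ℕ} (C : Code n M K)
    (hgood : ∀ m k, ∀ᵐ z ∂(noiseLaw p n), ∀ i, 0 < p (C.encode m k i + z i)) :
    C.errorProb p = (((Fintype.card (Fin M × Fin K) : ℕ) : ℝ≥0∞)⁻¹ * ∑ j : Fin M × Fin K,
      ∫⁻ y in {y | C.decode y j.2 ≠ j.1},
        ENNReal.ofReal (shiftDensity p (C.encode j.1 j.2) y) ∂(noiseLaw p n)).toReal := by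
  have := h.isProbabilityMeasure_noiseLaw n
  have h1 : ∀ j : Fin M × Fin K, ∫⁻ y in {y | C.decode y j.2 ≠ j.1},
        ENNReal.ofReal (shiftDensity p (C.encode j.1 j.2) y) ∂(noiseLaw p n)
      = noiseLaw p n {z | C.decode (C.encode j.1 j.2 + z) j.2 ≠ j.1} := by
    intro j
    have hs : MeasurableSet {y | C.decode y j.2 ≠ j.1} := (C.measurableSet_decode j.2 j.1).compl
    rw [← withDensity_apply _ hs, ← h.map_add_left_eq_withDensity (hgood j.1 j.2),
      Measure.map_apply (measurable_const_add_pi _) hs]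
    rfl
  simp only [h1]
  rw [ENNReal.toReal_mul, ENNReal.toReal_sum fun j _ => measure_ne_top _ _, Code.errorProb,
    ← Finset.sum_product', Finset.univ_product_univ]
  simp only [Fintype.card_prod, Fintype.card_fin, ENNReal.toReal_inv, ENNReal.toReal_natCast,
    Nat.cast_mul, ENNReal.toReal_mul, measureReal_def, mul_comm (K : ℝ)]

/-- A one-shot achievability bound for the noise vector. -/
theorem RegularDensity.achievable_of_le (h : RegularDensity p b ζ) {γ : ℝ} {μ : Measure ℝ}
    (hμ : IsTiltingInput p γ μ) (hγ : γ < 1 - ζ) {n M : ℕ} (hM : 0 < M) {Δ ε t c D : ℝ}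
    (hΔ : 0 < Δ) (hε : 0 < ε) (ht : 0 < t) (hc : 0 < c)
    (hD : n * (γ * deriv (cgf (surprisal p) (lawOf p)) γ - cgf (surprisal p) (lawOf p) γ) < D)
    (hD0 : 0 ≤ D)
    (htc : Real.log t + c ≤ n * ((1 - γ) * deriv (cgf (surprisal p) (lawOf p)) γ
      - ∫ z, surprisal p z ∂(lawOf p) + cgf (surprisal p) (lawOf p) γ))
    (hle : D / Δ + (n * Var[infoDensity p γ; μ.prod (lawOf p)] / c ^ 2 + M / t) / ε ≤ 1) :
    Achievable p n Δ ε M := by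
  have := hμ.isProbabilityMeasure
  have := h.isProbabilityMeasure_noiseLaw n
  have hch := hμ.isChannelDensity h hγ n
  have hthr := hμ.lintegral_threshold_le h hγ n ht hc
    (by rw [hμ.integral_infoDensity h hγ]; exact htc)
  -- The weights `1 / Δ` and `1 / ε` normalise both requirements: if the weighted sum is at most
  -- one, then each of them holds.
  obtain ⟨K, hK, c', hgood, dec, hdec, hbound⟩ := hch.exists_codebook (hμ.ae_good h hγ n) hM ht
    ((hμ.integral_mul_log_output h hγ n).trans_lt hD) (ENNReal.ofReal Δ)⁻¹ (ENNReal.ofReal ε)⁻¹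
  set C : Code n M K := ⟨fun m k => c' (m, k), dec, hdec⟩ with hC
  have hgood' : ∀ m k, ∀ᵐ z ∂(noiseLaw p n), ∀ i, 0 < p (C.encode m k i + z i) := fun m k =>
    hgood (m, k)
  have hΔ0 : ENNReal.ofReal Δ ≠ 0 := by simpa using hΔ
  have hε0 : ENNReal.ofReal ε ≠ 0 := by simpa using hε
  have hVar := variance_nonneg (infoDensity p γ) (μ.prod (lawOf p))
  have hone : (ENNReal.ofReal Δ)⁻¹ * ENNReal.ofReal D + (ENNReal.ofReal ε)⁻¹ *
      (ENNReal.ofReal (n * Var[infoDensity p γ; μ.prod (lawOf p)] / c ^ 2)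
        + ENNReal.ofReal (M / t)) ≤ 1 := by
    rw [← ENNReal.ofReal_add (by positivity) (by positivity), ← ENNReal.ofReal_inv_of_pos hΔ,
      ← ENNReal.ofReal_inv_of_pos hε, ← ENNReal.ofReal_mul (by positivity),
      ← ENNReal.ofReal_mul (by positivity), ← ENNReal.ofReal_add (by positivity) (by positivity)]
    refine ENNReal.ofReal_le_one.2 ?_
    rw [inv_mul_eq_div, inv_mul_eq_div]
    exact hle
  have htotal := hbound.trans ((add_le_add le_rfl (mul_le_mul' le_rfl
    (add_le_add hthr le_rfl))).trans hone)
  have hdiv : ∀ {a x y : ℝ≥0∞}, a ≠ 0 → a ≠ ∞ → a⁻¹ * x + y ≤ 1 → x ≤ a := by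
    intro a x y ha hat hxy
    have h1 : a⁻¹ * x ≤ 1 := le_self_add.trans hxy
    rwa [mul_comm, ← div_eq_mul_inv, ENNReal.div_le_iff ha hat, one_mul] at h1
  refine ⟨hM, K, hK, C, ?_, ?_⟩
  · have hg : Measurable fun y => ((Fintype.card (Fin M × Fin K) : ℕ) : ℝ)⁻¹ *
        ∑ j : Fin M × Fin K, shiftDensity p (C.encode j.1 j.2) y :=
      (Finset.measurable_fun_sum _ fun j _ => (h.measurable_shiftDensity n).comp
        (measurable_const.prodMk measurable_id)).const_mul _
    have hg0 : ∀ y, 0 ≤ ((Fintype.card (Fin M × Fin K) : ℕ) : ℝ)⁻¹ *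
        ∑ j : Fin M × Fin K, shiftDensity p (C.encode j.1 j.2) y := fun y =>
      mul_nonneg (by positivity) (Finset.sum_nonneg fun j _ => h.shiftDensity_nonneg _ _)
    have hfin : IsFiniteMeasure (C.outputLaw p) := by
      have := fun x : Fin n → ℝ => h.isProbabilityMeasure_map x
      refine ⟨?_⟩
      rw [Code.outputLaw, Measure.smul_apply, smul_eq_mul]
      refine ENNReal.mul_lt_top (ENNReal.inv_lt_top.2 ?_) (measure_lt_top _ _)
      have : 0 < K * M := Nat.mul_pos hK hM
      exact_mod_cast this
    rw [h.outputLaw_eq C hgood'] at hfin ⊢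
    rw [klDiv_withDensity_ofReal hg hg0 hfin]
    exact hdiv hΔ0 ENNReal.ofReal_ne_top htotal
  · rw [h.errorProb_eq C hgood']
    rw [add_comm] at htotal
    exact ENNReal.toReal_le_of_le_ofReal hε.le (hdiv hε0 ENNReal.ofReal_ne_top htotal)

end Achievability

/-! ### Scaling limits and the constant -/

section Limits

variable {p : ℝ → ℝ} {b ζ : ℝ}

theorem tendsto_sqrt_natCast_atTop : Tendsto (fun n : ℕ => √(n : ℝ)) atTop atTop :=
  Real.tendsto_sqrt_atTop.comp tendsto_natCast_atTop_atTop

theorem tendsto_div_sqrt_nhdsGT {c : ℝ} (hc : 0 < c) :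
    Tendsto (fun n : ℕ => c / √(n : ℝ)) atTop (𝓝[>] 0) := by
  refine tendsto_nhdsWithin_iff.2 ⟨tendsto_sqrt_natCast_atTop.const_div_atTop c, ?_⟩
  filter_upwards [eventually_gt_atTop 0] with n hn
  have : (0 : ℝ) < n := by exact_mod_cast hn
  exact div_pos hc (Real.sqrt_pos.2 this)

/-- The tilt is `c / √n`. With `R < R₁ < R₂ < c V`, the code has log-size about `R √n`, the
decoder's log-threshold is `R₁ √n`, and the mean information exceeds `R₂ √n`. The gap below `R₁`
defeats wrong codewords, and the gap above it is the deviation handed to Chebyshev. -/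
theorem RegularDensity.eventually_achievable (h : RegularDensity p b ζ) {ξ : ℝ} (hξ : 0 < ξ)
    (hdec : ∀ γ ∈ Set.Ico 0 ξ, IsAdditiveOutput p (tilted p γ)) {Δ ε c R : ℝ} (hΔ : 0 < Δ)
    (hε : 0 < ε) (hc : 0 < c) (hcV : c ^ 2 * (Var[surprisal p; lawOf p] / 2) < Δ)
    (hR : 0 < R) (hRc : R < c * Var[surprisal p; lawOf p]) :
    ∀ᶠ n : ℕ in atTop, Achievable p n Δ ε ⌊Real.exp (R * √n)⌋₊ := by
  have := h.isProbabilityMeasure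
  set V := Var[surprisal p; lawOf p] with hV
  obtain ⟨D, hD1, hD2⟩ := exists_between hcV
  obtain ⟨R₂, hR2, hR2c⟩ := exists_between hRc
  obtain ⟨R₁, hR1, hR12⟩ := exists_between hR2
  have hV0 : 0 ≤ V := variance_nonneg _ _
  have hD0 : 0 ≤ D := le_trans (by positivity) hD1.le
  have hgap : 0 < R₂ - R₁ := sub_pos.2 hR12
  -- The divergence uses the fraction `D / Δ` of the unit budget; what remains is shared equally by
  -- the two error terms.
  set κ := (1 - D / Δ) * ε / 2 with hκ
  have hκ0 : 0 < κ := by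
    have : D / Δ < 1 := (div_lt_one hΔ).2 hD2
    have : 0 < 1 - D / Δ := by linarith
    positivity
  have hγ := tendsto_div_sqrt_nhdsGT hc
  have e1 := hγ.eventually (mem_nhdsWithin_of_mem_nhds (Iio_mem_nhds hξ))
  have e2 := hγ.eventually (mem_nhdsWithin_of_mem_nhds (Iio_mem_nhds h.zero_lt_one_sub))
  have e3 := hγ.eventually (h.eventually_variance_le (ρ := κ * (R₂ - R₁) ^ 2) (by positivity))
  have e4 := ((h.tendsto_divergence.comp hγ).const_mul (c ^ 2)).eventually_lt_const hD1
  have e5 := ((h.tendsto_information.comp hγ).const_mul c).eventually_const_lt hR2c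
  have e6 : ∀ᶠ n : ℕ in atTop, Real.exp (-((R₁ - R) * √(n : ℝ))) < κ := by
    have := Real.tendsto_exp_neg_atTop_nhds_zero.comp
      (tendsto_sqrt_natCast_atTop.const_mul_atTop (sub_pos.2 hR1))
    exact this.eventually_lt_const hκ0
  filter_upwards [e1, e2, e3, e4, e5, e6, eventually_gt_atTop 0] with n g1 g2 g3 g4 g5 g6 hn
  have hn' : (0 : ℝ) < n := by exact_mod_cast hn
  set q := √(n : ℝ) with hq
  have hq0 : 0 < q := Real.sqrt_pos.2 hn'
  have hqq : (n : ℝ) = q ^ 2 := (Real.sq_sqrt hn'.le).symm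
  set γ := c / q with hγdef
  have hγ0 : 0 < γ := div_pos hc hq0
  simp only [Function.comp] at g4 g5
  obtain ⟨μ, hμ⟩ := h.exists_isTiltingInput (le_of_lt g2) (hdec γ ⟨hγ0.le, g1⟩)
  have hM : 0 < ⌊Real.exp (R * q)⌋₊ :=
    Nat.floor_pos.2 (Real.one_le_exp (mul_nonneg hR.le hq0.le))
  have hcγ : ∀ x : ℝ, n * x = c ^ 2 * (x / γ ^ 2) := fun x => by
    rw [hqq, hγdef]
    field_simp
  have hcγ' : ∀ x : ℝ, n * x = c * (x / γ) * q := fun x => by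
    rw [hqq, hγdef]
    field_simp
  refine h.achievable_of_le hμ g2 hM (t := Real.exp (R₁ * q)) (c := (R₂ - R₁) * q) (D := D) hΔ hε
    (Real.exp_pos _) (mul_pos hgap hq0) ?_ hD0 ?_ ?_
  · rw [hcγ]
    exact g4
  · rw [Real.log_exp, hcγ']
    calc R₁ * q + (R₂ - R₁) * q = R₂ * q := by ring
      _ ≤ _ := mul_le_mul_of_nonneg_right g5.le hq0.le
  · have v1 : n * Var[infoDensity p γ; μ.prod (lawOf p)] / ((R₂ - R₁) * q) ^ 2 ≤ κ := by
      rw [div_le_iff₀ (by positivity), mul_pow, hqq]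
      have := mul_le_mul_of_nonneg_left (g3 μ hμ) (sq_nonneg q)
      linarith
    have v2 : (⌊Real.exp (R * q)⌋₊ : ℝ) / Real.exp (R₁ * q) ≤ κ := by
      calc _ ≤ Real.exp (R * q) / Real.exp (R₁ * q) := by
            gcongr
            exact Nat.floor_le (Real.exp_pos _).le
        _ = Real.exp (-((R₁ - R) * q)) := by rw [← Real.exp_sub]; ring_nf
        _ ≤ κ := g6.le
    calc _ ≤ D / Δ + (κ + κ) / ε := by gcongr
      _ = 1 := by
        rw [hκ]
        field_simp
        ring

theorem RegularDensity.achievable_one (h : RegularDensity p b ζ) (n : ℕ) {Δ ε : ℝ}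
    (hε : 0 < ε) : Achievable p n Δ ε 1 := by
  have := h.isProbabilityMeasure_noiseLaw n
  refine ⟨one_pos, 1, one_pos, ⟨fun _ _ => 0, fun _ _ => 0, fun _ _ => by simp⟩, ?_, ?_⟩
  · have : (⟨fun _ _ => 0, fun _ _ => 0, fun _ _ => by simp⟩ : Code n 1 1).outputLaw p
        = noiseLaw p n := by
      simp [Code.outputLaw]
    rw [this, InformationTheory.klDiv_self]
    exact zero_le
  · simp [Code.errorProb, hε.le]

theorem RegularDensity.maxLogSize_nonneg (h : RegularDensity p b ζ) (n : ℕ) {Δ ε : ℝ}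
    (hε : 0 < ε) : 0 ≤ maxLogSize p n Δ ε := by
  refine le_trans ?_ (le_iSup₂ (f := fun (M : ℕ) (_ : Achievable p n Δ ε M) =>
    ((Real.log M : ℝ) : EReal)) 1 (h.achievable_one n hε))
  simp

theorem sub_log_two_le_log_floor {x : ℝ} (hx : 1 ≤ x) :
    Real.log x - Real.log 2 ≤ Real.log ⌊x⌋₊ := by
  have h1 : (1 : ℝ) ≤ ⌊x⌋₊ := by exact_mod_cast Nat.floor_pos.2 hx
  have h2 := Nat.lt_floor_add_one x
  rw [← Real.log_div (by positivity) (by norm_num)]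
  exact Real.log_le_log (by positivity) (by linarith)

theorem RegularDensity.le_liminf (h : RegularDensity p b ζ) {ξ : ℝ} (hξ : 0 < ξ)
    (hdec : ∀ γ ∈ Set.Ico 0 ξ, IsAdditiveOutput p (tilted p γ)) {Δ ε x : ℝ} (hΔ : 0 < Δ)
    (hε : 0 < ε) (hx : x < √2 * √(Var[surprisal p; lawOf p])) :
    (x : EReal) ≤ liminf (fun n : ℕ => maxLogSize p n Δ ε / ((√(n * Δ) : ℝ) : EReal)) atTop := by
  -- Negative `x` is covered by the one-message code. In the other case `V` is positive, so dividing
  -- by it is legitimate.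
  rcases lt_or_ge x 0 with hx0 | hx0
  · refine le_liminf_of_le (by isBoundedDefault) (Eventually.of_forall fun n => ?_)
    refine le_trans (b := 0) (by exact_mod_cast hx0.le) ?_
    exact EReal.div_nonneg (h.maxLogSize_nonneg n hε) (by exact_mod_cast Real.sqrt_nonneg _)
  set V := Var[surprisal p; lawOf p] with hV
  have hV0 : 0 < V := by
    by_contra hneg
    rw [Real.sqrt_eq_zero_of_nonpos (not_lt.1 hneg), mul_zero] at hx
    linarith
  obtain ⟨y', hxy', hy'⟩ := exists_between hx
  obtain ⟨y, hxy, hyy'⟩ := exists_between hxy'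
  have hy0 : 0 < y := by linarith
  have hy'0 : 0 < y' := by linarith
  have hsΔ : 0 < √Δ := Real.sqrt_pos.2 hΔ
  have hsq : √Δ ^ 2 = Δ := Real.sq_sqrt hΔ.le
  have hy'2 : y' ^ 2 < 2 * V := by
    have := pow_lt_pow_left₀ hy' hy'0.le two_ne_zero
    rwa [mul_pow, Real.sq_sqrt (by norm_num), Real.sq_sqrt hV0.le] at this
  -- With this `c` the divergence tends to `Δ y'² / (2 V) < Δ` and the attainable rates reach `c V =
  -- y' √Δ`; the step from `y` down to `x` absorbs the rounding of the number of messages.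
  have hach := h.eventually_achievable hξ hdec (c := y' * √Δ / V) (R := y * √Δ) hΔ hε
    (by positivity) (by
      rw [← hV]
      have : (y' * √Δ / V) ^ 2 * (V / 2) = y' ^ 2 / (2 * V) * Δ := by
        rw [div_pow, mul_pow, hsq]
        field_simp
      rw [this]
      have : y' ^ 2 / (2 * V) < 1 := (div_lt_one (by positivity)).2 hy'2
      nlinarith) (by positivity) (by
      rw [← hV, div_mul_cancel₀ _ hV0.ne']
      gcongr)
  have hlim : ∀ᶠ n : ℕ in atTop, x * √Δ < y * √Δ - Real.log 2 / √(n : ℝ) := by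
    have h1 : Tendsto (fun n : ℕ => y * √Δ - Real.log 2 / √(n : ℝ)) atTop (𝓝 (y * √Δ - 0)) :=
      (tendsto_sqrt_natCast_atTop.const_div_atTop _).const_sub _
    refine h1.eventually_const_lt ?_
    rw [sub_zero]
    gcongr
  refine le_liminf_of_le (by isBoundedDefault) ?_
  filter_upwards [hach, hlim, eventually_gt_atTop 0] with n g1 g2 hn
  have hn' : (0 : ℝ) < n := by exact_mod_cast hn
  have hq0 : 0 < √(n : ℝ) := Real.sqrt_pos.2 hn'
  have hle := le_iSup₂ (f := fun (M : ℕ) (_ : Achievable p n Δ ε M) =>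
    ((Real.log M : ℝ) : EReal)) _ g1
  have hfl := sub_log_two_le_log_floor (Real.one_le_exp
    (mul_nonneg (mul_nonneg hy0.le hsΔ.le) hq0.le) : 1 ≤ Real.exp (y * √Δ * √(n : ℝ)))
  rw [Real.log_exp] at hfl
  rw [EReal.le_div_iff_mul_le (by exact_mod_cast Real.sqrt_pos.2 (mul_pos hn' hΔ))
    (EReal.coe_ne_top _)]
  refine le_trans ?_ hle
  rw [← EReal.coe_mul, EReal.coe_le_coe_iff]
  refine le_trans ?_ hfl
  have := mul_le_mul_of_nonneg_right g2.le hq0.le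
  rw [sub_mul, div_mul_cancel₀ _ hq0.ne'] at this
  rw [Real.sqrt_mul hn'.le]
  linarith

/-- The converse at tilt `c / √n`, with `c` left free so that it can be optimised after the limit in
`n`. -/
theorem RegularDensity.liminf_le (h : RegularDensity p b ζ) {Δ ε c : ℝ} (hΔ : 0 < Δ)
    (hε : ε < 1) (hc : 0 < c) :
    liminf (fun n : ℕ => maxLogSize p n Δ ε / ((√(n * Δ) : ℝ) : EReal)) atTop
      ≤ (((c * (Var[surprisal p; lawOf p] / 2) + Δ / c) / ((1 - ε) * √Δ) : ℝ) : EReal) := by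
  set V := Var[surprisal p; lawOf p] with hV
  set f := cgf (surprisal p) (lawOf p) with hf
  set H := ∫ z, surprisal p z ∂(lawOf p) with hH
  have hγ := tendsto_div_sqrt_nhdsGT hc
  have hsΔ : 0 < √Δ := Real.sqrt_pos.2 hΔ
  have hε' : 0 < 1 - ε := by linarith
  set B : ℕ → ℝ := fun n => (c * ((f (c / √(n : ℝ)) - c / √(n : ℝ) * H) / (c / √(n : ℝ)) ^ 2)
    + Δ / c + 1 / √(n : ℝ)) / ((1 - ε) * √Δ) with hB
  have hBlim : Tendsto B atTop (𝓝 ((c * (V / 2) + Δ / c) / ((1 - ε) * √Δ))) := by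
    have h1 := (((h.tendsto_cgf_second_order.comp hγ).const_mul c).add_const (Δ / c)).add
      (tendsto_sqrt_natCast_atTop.const_div_atTop 1)
    rw [add_zero] at h1
    exact h1.div_const _
  have hBlim' : Tendsto (fun n => ((B n : ℝ) : EReal)) atTop
      (𝓝 (((c * (V / 2) + Δ / c) / ((1 - ε) * √Δ) : ℝ) : EReal)) :=
    (continuous_coe_real_ereal.tendsto _).comp hBlim
  rw [← hBlim'.liminf_eq]
  refine liminf_le_liminf ?_ (by isBoundedDefault) (by isBoundedDefault)
  filter_upwards [hγ.eventually (mem_nhdsWithin_of_mem_nhds (Iio_mem_nhds h.zero_lt_one_sub)),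
    eventually_gt_atTop 0] with n g1 hn
  have hn' : (0 : ℝ) < n := by exact_mod_cast hn
  have hq0 : 0 < √(n : ℝ) := Real.sqrt_pos.2 hn'
  have hqq : (n : ℝ) = √(n : ℝ) ^ 2 := (Real.sq_sqrt hn'.le).symm
  rw [EReal.div_le_iff_le_mul (by exact_mod_cast Real.sqrt_pos.2 (mul_pos hn' hΔ))
    (EReal.coe_ne_top _)]
  refine iSup₂_le fun M hA => ?_
  rw [← EReal.coe_mul, EReal.coe_le_coe_iff]
  have hlog := h.log_card_le hΔ.le hA (div_pos hc hq0) (le_of_lt g1)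
  rw [← hf, ← hH] at hlog
  have hBn : B n * √(n * Δ) * (1 - ε) = n * (f (c / √(n : ℝ)) - c / √(n : ℝ) * H) / (c / √(n : ℝ))
      + Δ / (c / √(n : ℝ)) + 1 := by
    rw [Real.sqrt_mul hn'.le]
    simp only [hB]
    generalize f (c / √(n : ℝ)) - c / √(n : ℝ) * H = F
    rw [show (n : ℝ) * F = √(n : ℝ) ^ 2 * F by rw [← hqq]]
    have h1 := hε'.ne'
    have h2 := hsΔ.ne'
    have h3 := hq0.ne'
    generalize √(n : ℝ) = q at h3 ⊢
    generalize √Δ = d at h2 ⊢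
    generalize 1 - ε = e at h1 ⊢
    field_simp
  rw [← hBn] at hlog
  refine le_of_mul_le_mul_right ?_ hε'
  linarith

theorem RegularDensity.isScalingConstant (h : RegularDensity p b ζ) {ξ : ℝ} (hξ : 0 < ξ)
    (hdec : ∀ γ ∈ Set.Ico 0 ξ, IsAdditiveOutput p (tilted p γ)) {Δ : ℝ} (hΔ : 0 < Δ) :
    IsScalingConstant p Δ (√2 * √(Var[surprisal p; lawOf p])) := by
  set V := Var[surprisal p; lawOf p] with hV
  have hV0 : 0 ≤ V := variance_nonneg _ _
  refine tendsto_order.2 ⟨fun a ha => ?_, fun a ha => ?_⟩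
  · obtain ⟨x, hax, hx⟩ := EReal.lt_iff_exists_real_btwn.1 ha
    filter_upwards [self_mem_nhdsWithin] with ε hε
    exact hax.trans_le (h.le_liminf hξ hdec hΔ hε (EReal.coe_lt_coe_iff.1 hx))
  · obtain ⟨x, hx, hxa⟩ := EReal.lt_iff_exists_real_btwn.1 ha
    have hx' := EReal.coe_lt_coe_iff.1 hx
    have hsΔ : 0 < √Δ := Real.sqrt_pos.2 hΔ
    have hx0 : 0 < x := lt_of_le_of_lt (by positivity) hx'
    have hxV : 2 * V < x ^ 2 := by
      have := pow_lt_pow_left₀ hx' (by positivity) two_ne_zero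
      rwa [mul_pow, Real.sq_sqrt (by norm_num), Real.sq_sqrt hV0] at this
    -- The optimal `c` would be `√(2 Δ / V)`. Using `x`, slightly above `√(2 V)`, instead of `√(2
    -- V)` gives the bound `V / x + x / 2 < x` and also covers `V = 0`.
    set c := 2 * √Δ / x with hc
    have hc0 : 0 < c := by positivity
    have hval : (c * (V / 2) + Δ / c) / ((1 - 0) * √Δ) < x := by
      have e1 : (c * (V / 2) + Δ / c) / ((1 - 0) * √Δ) = V / x + x / 2 := by
        rw [hc]
        nth_rw 2 [← Real.mul_self_sqrt hΔ.le]
        field_simp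
        ring
      have e2 : V / x < x / 2 := by
        rw [div_lt_iff₀ hx0]
        nlinarith
      linarith
    have hcont : ContinuousAt (fun ε : ℝ => (c * (V / 2) + Δ / c) / ((1 - ε) * √Δ)) 0 := by
      refine ContinuousAt.div (by fun_prop) (by fun_prop) ?_
      simpa using hsΔ.ne'
    filter_upwards [mem_nhdsWithin_of_mem_nhds (hcont.eventually_lt continuousAt_const hval),
      mem_nhdsWithin_of_mem_nhds (Iio_mem_nhds (one_pos : (0 : ℝ) < 1))] with ε h1 h2
    exact (h.liminf_le hΔ h2 hc0).trans_lt ((EReal.coe_lt_coe_iff.2 h1).trans hxa)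

/-- A density as in the theorem agrees almost everywhere with a measurable and bounded one. -/
theorem exists_regularDensity {p : ℝ → ℝ} (hp : IsPDF p) {b₀ : ℝ} (hb : ∀ z, p z ≤ b₀) {ζ : ℝ}
    (hζ : ζ ∈ Set.Ioo (0 : ℝ) 1) (hint : Integrable (fun z => p z ^ ζ) volume) :
    ∃ p', p =ᵐ[volume] p' ∧ RegularDensity p' (max b₀ 1) ζ := by
  obtain ⟨g, hg, hpg⟩ := hp.integrable.aestronglyMeasurable.aemeasurable
  set p' : ℝ → ℝ := fun z => min (max (g z) 0) (max b₀ 1) with hp'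
  have hae : p =ᵐ[volume] p' := by
    filter_upwards [hpg] with z hz
    rw [hp']
    -- Clipping a measurable representative to `[0, max b₀ 1]` makes nonnegativity and the bound
    -- hold everywhere, and changes nothing where it agrees with `p`.
    simp only
    rw [← hz, max_eq_left (hp.nonneg z), min_eq_left ((hb z).trans (le_max_left _ _))]
  refine ⟨p', hae, (hg.max measurable_const).min measurable_const, fun z => ?_, le_max_right _ _,
    fun z => min_le_right _ _, hp.integrable.congr hae, ?_, hζ, hint.congr ?_⟩
  · exact le_min (le_max_right _ _) (zero_le_one.trans (le_max_right _ _))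
  · rw [← integral_congr_ae hae, hp.integral_eq_one]
  · filter_upwards [hae] with z hz
    rw [hz]

theorem lawOf_congr {p q : ℝ → ℝ} (hpq : p =ᵐ[volume] q) : lawOf p = lawOf q :=
  withDensity_congr_ae (hpq.mono fun z hz => by simp only [hz])

theorem tilted_congr {p q : ℝ → ℝ} (hpq : p =ᵐ[volume] q) (γ : ℝ) :
    tilted p γ =ᵐ[volume] tilted q γ := by
  have h1 : (fun t => p t ^ (1 - γ)) =ᵐ[volume] fun t => q t ^ (1 - γ) :=
    hpq.mono fun z hz => by simp only [hz]
  filter_upwards [hpq] with z hz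
  rw [tilted, tilted, integral_congr_ae h1, hz]

theorem IsScalingConstant.congr {p q : ℝ → ℝ} (hpq : lawOf p = lawOf q) {Δ L : ℝ}
    (h : IsScalingConstant p Δ L) : IsScalingConstant q Δ L := by
  have hn : ∀ n, noiseLaw p n = noiseLaw q n := fun n => by rw [noiseLaw, noiseLaw, hpq]
  simpa only [IsScalingConstant, maxLogSize, Achievable, Code.outputLaw, Code.errorProb, hn] using h

end Limits

end Covert

theorem theorem2 (p : ℝ → ℝ) (hp : Covert.IsPDF p)
    (hint : Covert.IntegrabilityConditions p) (hass : Covert.TightnessAssumption p)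
    (Δ : ℝ) (hΔ : 0 < Δ) :
    Covert.IsScalingConstant p Δ
      (√2 * √(variance (fun z => Real.log (p z)) (Covert.lawOf p))) := by
  obtain ⟨ζ, hζ, -, hrpow, -⟩ := hint
  obtain ⟨b₀, -, hb⟩ := hass.bounded
  obtain ⟨ξ, hξ, hdec⟩ := hass.decomposable
  -- The scaling constant depends on the density only through its law, so `p` may be replaced by a
  -- measurable and bounded representative; the variance and the decomposability assumption transfer
  -- as well.
  obtain ⟨p', hae, hreg⟩ := Covert.exists_regularDensity hp hb hζ hrpow
  have hlaw := Covert.lawOf_congr hae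
  have hvar : variance (fun z => Real.log (p z)) (Covert.lawOf p) =
      Var[Covert.surprisal p'; Covert.lawOf p'] := by
    have h1 :
        (fun z => Real.log (p z)) =ᵐ[Covert.lawOf p'] fun z => -Covert.surprisal p' z := by
      have : ∀ᵐ z ∂(Covert.lawOf p'), p z = p' z :=
        (withDensity_absolutelyContinuous _ _).ae_le hae
      filter_upwards [this] with z hz
      rw [Covert.surprisal, neg_neg, hz]
    rw [hlaw, variance_congr h1]
    exact variance_fun_neg
  rw [hvar]
  refine (hreg.isScalingConstant hξ.1 (fun γ hγ => ?_) hΔ).congr hlaw.symm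
  obtain ⟨Ω, mΩ, P, X, Z, h1, h2, h3, h4, h5, h6⟩ := hdec γ hγ
  exact ⟨Ω, mΩ, P, X, Z, h1, h2, h3, h4, h5.trans hlaw,
    h6.trans (Covert.lawOf_congr (Covert.tilted_congr hae γ))⟩
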